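/- **Setting.** For integers $d, N \ge 1$ let $E = (\mathbb Z/N\mathbb Z)^d \times \mathbb Z$ with its nearest-neighbour graph structure, and let $\pi_E : \mathbb Z^{d+1} \to E$ be the canonical projection. For $j \in \mathbb Z$ set $$B_j = (\mathbb Z/N\mathbb Z)^d \times [(j-1)N, (j+1)N], \qquad \widetilde B_j = (\mathbb Z/N\mathbb Z)^d \times [(j-2)N+1, (j+2)N-1],$$ $$C_j = (\mathbb Z/N\mathbb Z)^d \times \big([(j-\tfrac34)N, (j+\tfrac34)N] \cap \mathbb Z\big).$$ Let $P$ (with expectation $E[\cdot]$) be the law of simple random walk $(X_n)_{n \ge 0}$ on $E$ with $X_0$ uniformly distributed on $B_0$. Let $H_x = \inf\{n \ge 0 : X_n = x\}$. Let $D^j_0 = 0$ and, for $k \ge 0$, let $R^j_{k+1} = \inf\{n \ge D^j_k : X_n \in B_j\}$ and $D^j_{k+1} = \inf\{n \ge R^j_{k+1} : X_n \notin \widetilde B_j\}$; for real $t \ge 0$ put $D^j_t = D^j_{[t]}$. For $m \ge 1$ let $\mathcal A^j_m$ be the collection of non-empty sets $A \subseteq C_j$ that are contained in $\pi_E\big(y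 + \sum_{i \in I} \mathbb Z e_i\big)$ for some $y \in \mathbb Z^{d+1}$ and some $I \subseteq \{1, \dots, d+1\}$ with $|I| = m$, where $(e_i)$ is the canonical basis. Finally let $q(\nu)$ be the probability that simple random walk on $\mathbb Z^\nu$ started at the origin returns to the origin at some time $n \ge 1$. **Theorem 1.2.** Let $d \ge 3$. There is a constant $c > 0$ depending only on $d$ such that the following holds for all integers $1 \le m \le d-2$ and all $\lambda > 0$ with $$\chi(\lambda) := e^\lambda \Big( \frac{m}{d+1} + \Big(1 - \frac{m}{d+1}\Big) q(d+1-m) \Big) < 1 .$$ For every $u > 0$, $$\limsup_{N \to \infty} \ \sup_{j \in \mathbb Z,\, A \in \mathcal A^j_m} |A|^{-1} \log E\Big[ e^{\lambda \sum_{x \in A} 1\{H_x \le D^j_{uN^{d-1}}\}} \Big] \le c\, u\, \frac{e^\lambda - 1}{1 - \chi(\lambda)} ,$$ and there exist $N_1 = N_1(d,m,\lambda) > 0$ and $u_1 = u_1(d,m,\lambda) > 0$ such that for all $N \ge N_1$, $$P\big[ X_{[0, D^j_{u_1 N^{d-1}}]} \supseteq A \big] \le e^{-\lambda |A|} \quad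 \text{for all } j \in \mathbb Z \text{ and } A \in \mathcal A^j_m .$$ -/

import Mathlib

open MeasureTheory ProbabilityTheory Filter

namespace CylinderWalk

/-! ### Random walks, entrance and hitting times -/

/-- The law on path space of the random walk on a group `G` with initial distribution `μ` whose
increments are independent and uniformly distributed on the set `S` of allowed steps. If `S` is the
set of neighbours of the origin in a translation invariant graph on `G`, this is the law of simple
random walk on that graph. -/
noncomputable def walkLaw {G : Type*} [AddCommGroup G] [MeasurableSpace G]
    (μ : Measure G) (S : Set G) : Measure (ℕ → G) :=
  (μ.prod (Measure.infinitePi fun _ : ℕ => uniformOn S)).map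
    fun p n => p.1 + ∑ k ∈ Finset.range n, p.2 k

/-- `inf {n ≥ t : ω n ∈ U}`, with value `⊤` if there is no such `n`, in particular if `t = ⊤`.
For `t = 0` this is the entrance time `H_U`, for `t = 1` the hitting time of `U`; in general it
is `H_U ∘ θ_t + t`. With `Uᶜ` in place of `U` it is `T_U ∘ θ_t + t`, `T_U` the exit time. -/
noncomputable def entranceFrom {G : Type*} (U : Set G) (t : ℕ∞) (ω : ℕ → G) : ℕ∞ :=
  ⨅ (n : ℕ) (_ : t ≤ (n : ℕ∞) ∧ ω n ∈ U), (n : ℕ∞)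

/-- The vectors of `ℤ^ν` of Euclidean norm one, i.e. the neighbours of the origin. -/
def unitVectors (ν : ℕ) : Set (Fin ν → ℤ) := {s | ∑ i, |s i| = 1}

/-- `q(ν)`: the probability that simple random walk on `ℤ^ν` started at the origin returns to the
origin at some time `n ≥ 1`. -/
noncomputable def returnProb (ν : ℕ) : ℝ :=
  (walkLaw (Measure.dirac (0 : Fin ν → ℤ)) (unitVectors ν)).real
    {ω | entranceFrom {0} 1 ω < ⊤}

/-! ### The discrete cylinder -/

/-- The discrete cylinder `E = (ℤ/Nℤ)^d × ℤ`. -/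
abbrev Cylinder (d N : ℕ) : Type := (Fin d → ZMod N) × ℤ

/-- The canonical projection `π_E` of `ℤ^(d+1)` onto the cylinder. -/
def proj (d N : ℕ) (x : Fin (d + 1) → ℤ) : Cylinder d N :=
  (fun i => (x i.castSucc : ZMod N), x (Fin.last d))

/-- The neighbours of the origin in the cylinder, i.e. its points at distance one. -/
def steps (d N : ℕ) : Set (Cylinder d N) := proj d N '' unitVectors (d + 1) \ {0}

/-- `B_j = (ℤ/Nℤ)^d × [(j - 1) N, (j + 1) N]`. -/
def innerBlock (d N : ℕ) (j : ℤ) : Set (Cylinder d N) :=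
  {x | (j - 1) * N ≤ x.2 ∧ x.2 ≤ (j + 1) * N}

/-- `B̃_j = (ℤ/Nℤ)^d × [(j - 2) N + 1, (j + 2) N - 1]`. -/
def outerBlock (d N : ℕ) (j : ℤ) : Set (Cylinder d N) :=
  {x | (j - 2) * N + 1 ≤ x.2 ∧ x.2 ≤ (j + 2) * N - 1}

/-- `C_j = (ℤ/Nℤ)^d × ([(j - 3/4) N, (j + 3/4) N] ∩ ℤ)`. -/
def block (d N : ℕ) (j : ℤ) : Set (Cylinder d N) :=
  {x | ((j : ℝ) - 3 / 4) * N ≤ (x.2 : ℝ) ∧ (x.2 : ℝ) ≤ ((j : ℝ) + 3 / 4) * N}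

/-- The law `P` of simple random walk on the cylinder whose starting point is uniformly distributed
on `B_0`. -/
noncomputable def cylLaw (d N : ℕ) : Measure (ℕ → Cylinder d N) :=
  walkLaw (uniformOn (innerBlock d N 0)) (steps d N)

/-- The successive departures `D^j_k`: `D^j_0 = 0`, and `D^j_(k+1)` is the first exit from `B̃_j`
after the return time `R^j_(k+1)`, which is the first visit to `B_j` from time `D^j_k` on. -/
noncomputable def departure (d N : ℕ) (j : ℤ) : ℕ → (ℕ → Cylinder d N) → ℕ∞
  | 0, _ => 0
  | k + 1, ω =>
      entranceFrom (outerBlock d N j)ᶜ (entranceFrom (innerBlock d N j) (departure d N j k ω) ω) ω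

/-- `ℒ_m`: the images under `π_E` of the affine lattices `y + ∑_{i ∈ I} ℤ e_i` with `|I| = m`. -/
def latticeSections (d N m : ℕ) : Set (Set (Cylinder d N)) :=
  {F | ∃ (I : Finset (Fin (d + 1))) (y : Fin (d + 1) → ℤ), I.card = m ∧
    F = proj d N '' {x | ∀ i, i ∉ I → x i = y i}}

/-- `𝒜^j_m`: the non-empty subsets of `C_j` contained in some element of `ℒ_m`
(they are finite as soon as `N ≥ 1`). -/
def admissible (d N m : ℕ) (j : ℤ) : Set (Finset (Cylinder d N)) :=
  {A | A.Nonempty ∧ (A : Set (Cylinder d N)) ⊆ block d N j ∧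
    ∃ F ∈ latticeSections d N m, (A : Set (Cylinder d N)) ⊆ F}

open Classical in
/-- `∑_{x ∈ A} 1{H_x ≤ D^j_t}`, with `D^j_t = D^j_[t]` for real `t ≥ 0`: the number of points of `A`
visited by time `D^j_t`. -/
noncomputable def visited (d N : ℕ) (j : ℤ) (A : Finset (Cylinder d N)) (t : ℝ)
    (ω : ℕ → Cylinder d N) : ℝ :=
  ∑ x ∈ A, if entranceFrom {x} 0 ω ≤ departure d N j ⌊t⌋₊ ω then 1 else 0

/-- The event `X_[0, D^j_t] ⊇ A`. -/
def coversBy (d N : ℕ) (j : ℤ) (A : Finset (Cylinder d N)) (t : ℝ) :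
    Set (ℕ → Cylinder d N) :=
  {ω | ∀ x ∈ A, ∃ n : ℕ, (n : ℕ∞) ≤ departure d N j ⌊t⌋₊ ω ∧ ω n = x}

/-- `χ(λ) = e^λ (m/(d+1) + (1 - m/(d+1)) q(d+1-m))`. -/
noncomputable def chi (d m : ℕ) (lam : ℝ) : ℝ :=
  Real.exp lam * ((m : ℝ) / (d + 1) + (1 - (m : ℝ) / (d + 1)) * returnProb (d + 1 - m))

end CylinderWalk

/-!
Let `γ` be such that `e^λ (1 + γ ρ) ≤ 1 + γ`, where `ρ` bounds the probability of returning to `A`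
from a point of `A` before leaving `B̃_j`. By induction on the time horizon, the exponential moment
of the visits to `A` during one excursion started at `z` is at most `1 + γ P_z[H_A < T]`, with `T`
the exit time of `B̃_j`, and `γ` can be chosen of order `(e^λ - 1) / (1 - χ(λ))` once `e^λ ρ` is
close to `χ(λ)`.

* The walk transverse to an `m`-dimensional section of the lattice is lazy, and looks like the walk
  on `ℤ^(d+1-m)` up to a large finite time; this contributes `χ(λ)`. After that time the heat kernel
  of three transverse coordinates bounds the return probability, by a quantity of order
  `n^(-3/2) + N^(-3)` at time `n`, and the walk leaves `B̃_j` after a time of order `N²`.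
* From a distance of order `N`, or from the uniform distribution on `B_0`, a point of `A` is hit
  before `T` with probability `O(N^(1-d))`; this follows from comparison with an explicit
  superharmonic function, built from characters of the torus. So each excursion contributes a factor
  `1 + O(γ |A| N^(1-d))`, and `u N^(d-1)` excursions give `exp(O(γ u |A|))`.

The covering estimate is Chernoff's bound, with a `λ' > λ` for which still `χ(λ') < 1`.
-/

namespace CylinderWalk

/-! ### The Markov property -/

section Prepend

variable {G : Type*}

/-- The path that starts in `z` and then follows `ω`. -/
def prepend (z : G) (ω : ℕ → G) : ℕ → G
  | 0 => z
  | n + 1 => ω n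

@[simp] lemma prepend_zero (z : G) (ω : ℕ → G) : prepend z ω 0 = z := rfl

@[simp] lemma prepend_succ (z : G) (ω : ℕ → G) (n : ℕ) : prepend z ω (n + 1) = ω n := rfl

variable [MeasurableSpace G]

lemma measurable_prepend : Measurable fun p : G × (ℕ → G) => prepend p.1 p.2 := by
  refine measurable_pi_lambda _ fun n => ?_
  cases n with
  | zero => exact measurable_fst
  | succ n => exact (measurable_pi_apply n).comp measurable_snd

lemma eq_infinitePi_of_forall_range {ν : Measure G} [IsProbabilityMeasure ν] {μ : Measure (ℕ → G)}
    (h : ∀ (n : ℕ) (t : ℕ → Set G), (∀ i, MeasurableSet (t i)) →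
      μ {ω | ∀ i < n, ω i ∈ t i} = ∏ i ∈ Finset.range n, ν (t i)) :
    μ = Measure.infinitePi fun _ => ν := by
  classical
  refine Measure.eq_infinitePi _ fun s t ht => ?_
  obtain ⟨n, hn⟩ : ∃ n, s ⊆ Finset.range n := s.exists_nat_subset_range
  set t' : ℕ → Set G := fun i => if i ∈ s then t i else Set.univ with ht'
  have hset : (s : Set ℕ).pi t = {ω | ∀ i < n, ω i ∈ t' i} := by
    ext ω
    refine ⟨fun hω i _ => ?_, fun hω i hi => ?_⟩
    · by_cases his : i ∈ s <;> simp [ht', his, hω i]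
    · simpa [ht', Finset.mem_coe.1 hi] using hω i (Finset.mem_range.1 (hn hi))
  rw [hset, h n t' fun i => by by_cases his : i ∈ s <;> simp [ht', his, ht i],
    ← Finset.prod_subset hn fun i _ hi => by simp [ht', hi]]
  exact Finset.prod_congr rfl fun i hi => by simp [ht', hi]

lemma map_prepend_infinitePi (ν : Measure G) [IsProbabilityMeasure ν] :
    (ν.prod (Measure.infinitePi fun _ : ℕ => ν)).map (fun p => prepend p.1 p.2) =
      Measure.infinitePi fun _ => ν := by
  refine eq_infinitePi_of_forall_range fun n t ht => ?_
  have hmeas : MeasurableSet {ω : ℕ → G | ∀ i < n, ω i ∈ t i} := by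
    measurability
  rw [Measure.map_apply measurable_prepend hmeas]
  cases n with
  | zero => simp
  | succ n =>
    have hpre : (fun p : G × (ℕ → G) => prepend p.1 p.2) ⁻¹' {ω | ∀ i < n + 1, ω i ∈ t i} =
        t 0 ×ˢ ((Finset.range n : Finset ℕ) : Set ℕ).pi fun i => t (i + 1) := by
      ext p
      simp only [Set.mem_preimage, Set.mem_ofPred_eq, Nat.forall_lt_succ_left, prepend_zero,
        prepend_succ, Set.mem_prod, Set.mem_pi, Finset.mem_coe, Finset.mem_range]
    rw [hpre, Measure.prod_prod, Measure.infinitePi_pi _ fun i _ => ht (i + 1),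
      Finset.prod_range_succ', mul_comm]

end Prepend

section Law

variable {G : Type*} [AddCommGroup G]

/-- The path of the walk that starts in `z` and has the increments `ξ`. -/
def walkPath (z : G) (ξ : ℕ → G) (n : ℕ) : G := z + ∑ k ∈ Finset.range n, ξ k

lemma walkPath_prepend (z s : G) (ξ : ℕ → G) :
    walkPath z (prepend s ξ) = prepend z (walkPath (z + s) ξ) := by
  funext n
  cases n with
  | zero => simp [walkPath]
  | succ n => simp [walkPath, Finset.sum_range_succ', add_assoc, add_comm s]

variable [MeasurableSpace G] [MeasurableAdd₂ G]

lemma measurable_walkPath : Measurable fun p : G × (ℕ → G) => walkPath p.1 p.2 :=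
  measurable_pi_lambda _ fun _ => measurable_fst.add
    (Finset.measurable_sum _ fun k _ => (measurable_pi_apply k).comp measurable_snd)

variable {S : Set G} [IsProbabilityMeasure (uniformOn S)]

instance isProbabilityMeasure_walkLaw (μ : Measure G) [IsProbabilityMeasure μ] :
    IsProbabilityMeasure (walkLaw μ S) :=
  Measure.isProbabilityMeasure_map measurable_walkPath.aemeasurable

variable {f : (ℕ → G) → ENNReal}

lemma lintegral_walkLaw_eq_lintegral_walkPath (μ : Measure G) (hf : Measurable f) :
    ∫⁻ ω, f ω ∂walkLaw μ S =
      ∫⁻ z, ∫⁻ ξ, f (walkPath z ξ) ∂(Measure.infinitePi fun _ => uniformOn S) ∂μ :=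
  (lintegral_map hf measurable_walkPath).trans
    (lintegral_prod _ (hf.comp measurable_walkPath).aemeasurable)

lemma lintegral_walkLaw_dirac_eq_lintegral_walkPath (z : G) (hf : Measurable f) :
    ∫⁻ ω, f ω ∂walkLaw (Measure.dirac z) S =
      ∫⁻ ξ, f (walkPath z ξ) ∂(Measure.infinitePi fun _ => uniformOn S) := by
  rw [lintegral_walkLaw_eq_lintegral_walkPath _ hf, lintegral_dirac']
  exact (hf.comp measurable_walkPath).lintegral_prod_right'

lemma lintegral_walkLaw (μ : Measure G) (hf : Measurable f) :
    ∫⁻ ω, f ω ∂walkLaw μ S = ∫⁻ z, ∫⁻ ω, f ω ∂walkLaw (Measure.dirac z) S ∂μ := by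
  simp only [lintegral_walkLaw_eq_lintegral_walkPath μ hf,
    lintegral_walkLaw_dirac_eq_lintegral_walkPath _ hf]

lemma lintegral_walkLaw_dirac (z : G) (hf : Measurable f) :
    ∫⁻ ω, f ω ∂walkLaw (Measure.dirac z) S =
      ∫⁻ s, ∫⁻ ω, f (prepend z ω) ∂walkLaw (Measure.dirac (z + s)) S ∂uniformOn S := by
  have hpath : Measurable (walkPath z) :=
    measurable_walkPath.comp (measurable_const.prodMk measurable_id)
  have hpre : Measurable fun ω : ℕ → G => prepend z ω :=
    measurable_prepend.comp (measurable_const.prodMk measurable_id)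
  calc ∫⁻ ω, f ω ∂walkLaw (Measure.dirac z) S
      = ∫⁻ ξ, f (walkPath z ξ) ∂((uniformOn S).prod (Measure.infinitePi fun _ => uniformOn S)).map
          fun p => prepend p.1 p.2 := by
        rw [map_prepend_infinitePi, lintegral_walkLaw_dirac_eq_lintegral_walkPath z hf]
    _ = ∫⁻ s, ∫⁻ ξ, f (prepend z (walkPath (z + s) ξ))
          ∂(Measure.infinitePi fun _ => uniformOn S) ∂uniformOn S := by
        simp only [← walkPath_prepend]
        exact (lintegral_map (hf.comp hpath) measurable_prepend).trans
          (lintegral_prod _ ((hf.comp hpath).comp measurable_prepend).aemeasurable)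
    _ = _ := lintegral_congr fun s =>
        (lintegral_walkLaw_dirac_eq_lintegral_walkPath (z + s) (hf.comp hpre)).symm

lemma lintegral_walkLaw_dirac_congr (z : G) {g : (ℕ → G) → ENNReal} (hf : Measurable f)
    (hg : Measurable g) (hfg : ∀ ω, f (prepend z ω) = g (prepend z ω)) :
    ∫⁻ ω, f ω ∂walkLaw (Measure.dirac z) S = ∫⁻ ω, g ω ∂walkLaw (Measure.dirac z) S := by
  simp only [lintegral_walkLaw_dirac z hf, lintegral_walkLaw_dirac z hg, hfg]

end Law

/-! ### Averages over neighbours -/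

section Average

variable {G ι : Type*} [AddCommGroup G] [Fintype ι]

/-- The transition operator of the random walk on `G` with the steps `±E i`: the value of
`stepAvg E f` at `z` is the mean of `f` over the points `z + E i` and `z - E i`. -/
noncomputable def stepAvg (E : ι → G) : (G → ℝ) →ₗ[ℝ] (G → ℝ) where
  toFun f z := (∑ i, (f (z + E i) + f (z - E i))) / (2 * Fintype.card ι)
  map_add' f g := by
    funext z
    simp only [Pi.add_apply, ← add_div, ← Finset.sum_add_distrib]
    congr! 2
    ring
  map_smul' c f := by
    funext z
    simp only [Pi.smul_apply, smul_eq_mul, ← mul_add, ← Finset.mul_sum, RingHom.id_apply]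
    ring

variable {E : ι → G} {f g : G → ℝ} {z : G}

lemma stepAvg_apply :
    stepAvg E f z = (∑ i, (f (z + E i) + f (z - E i))) / (2 * Fintype.card ι) := rfl

lemma stepAvg_le_stepAvg (h : ∀ i, f (z + E i) ≤ g (z + E i) ∧ f (z - E i) ≤ g (z - E i)) :
    stepAvg E f z ≤ stepAvg E g z := by
  simp only [stepAvg_apply]
  gcongr with i
  exacts [(h i).1, (h i).2]

lemma stepAvg_mono : Monotone (stepAvg E) := fun _ _ h _ =>
  stepAvg_le_stepAvg fun _ => ⟨h _, h _⟩

lemma stepAvg_nonneg (h : 0 ≤ f) : 0 ≤ stepAvg E f := by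
  simpa using stepAvg_mono (E := E) h

@[simp] lemma stepAvg_const [Nonempty ι] (c : ℝ) :
    stepAvg E (fun _ => c) = fun _ => c := by
  funext z
  have : (Fintype.card ι : ℝ) ≠ 0 := by simp
  simp only [stepAvg_apply, Finset.sum_const, Finset.card_univ, nsmul_eq_mul]
  field

lemma stepAvg_le_of_forall [Nonempty ι] {c : ℝ}
    (h : ∀ i, f (z + E i) ≤ c ∧ f (z - E i) ≤ c) : stepAvg E f z ≤ c :=
  (stepAvg_le_stepAvg (g := fun _ => c) h).trans_eq (congrFun (stepAvg_const c) z)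

lemma stepAvg_pow_succ (n : ℕ) (f : G → ℝ) :
    (stepAvg E ^ (n + 1)) f = stepAvg E ((stepAvg E ^ n) f) := by
  rw [pow_succ', Module.End.mul_apply]

lemma stepAvg_pow_mono (n : ℕ) : Monotone (stepAvg E ^ n) := by
  rw [Module.End.coe_pow]
  exact stepAvg_mono.iterate n

lemma stepAvg_pow_nonneg (h : 0 ≤ f) (n : ℕ) : 0 ≤ (stepAvg E ^ n) f := by
  simpa using stepAvg_pow_mono (E := E) n h

lemma stepAvg_pow_const [Nonempty ι] (c : ℝ) (n : ℕ) :
    (stepAvg E ^ n) (fun _ => c) = fun _ => c := by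
  induction n with
  | zero => rfl
  | succ n ih => rw [stepAvg_pow_succ, ih, stepAvg_const]

lemma stepAvg_pow_of_eigen {r : ℝ} (h : stepAvg E f = r • f) (n : ℕ) :
    (stepAvg E ^ n) f = r ^ n • f := by
  induction n with
  | zero => simp
  | succ n ih => rw [stepAvg_pow_succ, ih, map_smul, h, smul_smul, pow_succ]

lemma ofReal_stepAvg [Nonempty ι] (hf : 0 ≤ f) (z : G) :
    ENNReal.ofReal (stepAvg E f z) =
      (∑ i, (ENNReal.ofReal (f (z + E i)) + ENNReal.ofReal (f (z - E i)))) /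
        (2 * Fintype.card ι : ℕ) := by
  have : 0 < Fintype.card ι := Fintype.card_pos
  rw [stepAvg_apply, ENNReal.ofReal_div_of_pos (by positivity),
    ENNReal.ofReal_sum_of_nonneg fun i _ => add_nonneg (hf _) (hf _), ← ENNReal.ofReal_natCast]
  congr! 2 with i
  · exact ENNReal.ofReal_add (hf _) (hf _)
  · push_cast
    rfl

end Average

/-! ### Sets of steps -/

/-- The set `S` of steps of the walk consists of the pairwise distinct elements `E i` and `-E i`;
under this condition `stepAvg E` is the mean over the uniform distribution on `S`. -/
structure IsStepSet {G ι : Type*} [AddCommGroup G] (S : Set G) (E : ι → G) : Prop where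
  eq_union : S = Set.range E ∪ Set.range fun i => -E i
  injective : Function.Injective E
  ne_neg : ∀ i k, E i ≠ -E k

lemma lintegral_uniformOn_finset {G : Type*} [MeasurableSpace G] [MeasurableSingletonClass G]
    (s : Finset G) (f : G → ENNReal) :
    ∫⁻ x, f x ∂uniformOn (s : Set G) = (∑ x ∈ s, f x) / s.card := by
  rw [uniformOn, ProbabilityTheory.cond, lintegral_smul_measure, Measure.count_apply_finset,
    smul_eq_mul, ENNReal.div_eq_inv_mul, lintegral_finset]
  simp

namespace IsStepSet

variable {G ι : Type*} [AddCommGroup G] [Fintype ι] {S : Set G} {E : ι → G}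

lemma eq_coe [DecidableEq G] (h : IsStepSet S E) :
    S = ((Finset.univ.image E ∪ Finset.univ.image fun i => -E i : Finset G) : Set G) := by
  simp [h.eq_union]

lemma disjoint [DecidableEq G] (h : IsStepSet S E) :
    Disjoint (Finset.univ.image E) (Finset.univ.image fun i => -E i) := by
  simp only [Finset.disjoint_left, Finset.mem_image, Finset.mem_univ, true_and]
  rintro _ ⟨i, rfl⟩ ⟨k, hk⟩
  exact h.ne_neg i k hk.symm

variable [MeasurableSpace G] [MeasurableSingletonClass G]

omit [Fintype ι] in
lemma isProbabilityMeasure [Finite ι] [Nonempty ι] (h : IsStepSet S E) :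
    IsProbabilityMeasure (uniformOn S) := by
  classical
  have := Fintype.ofFinite ι
  rw [h.eq_coe]
  exact isProbabilityMeasure_uniformOn (Finset.finite_toSet _)
    ⟨E (Classical.arbitrary ι), by simp⟩

lemma lintegral_uniformOn (h : IsStepSet S E) (f : G → ENNReal) :
    ∫⁻ s, f s ∂uniformOn S = (∑ i, (f (E i) + f (-E i))) / (2 * Fintype.card ι : ℕ) := by
  classical
  have hneg : Function.Injective fun i => -E i := neg_injective.comp h.injective
  rw [h.eq_coe, lintegral_uniformOn_finset, Finset.sum_union h.disjoint,
    Finset.card_union_of_disjoint h.disjoint, Finset.card_image_of_injective _ h.injective,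
    Finset.card_image_of_injective _ hneg, Finset.sum_image h.injective.injOn,
    Finset.sum_image hneg.injOn, Finset.sum_add_distrib, Finset.card_univ, two_mul]

variable [Nonempty ι] [MeasurableAdd₂ G] {f : (ℕ → G) → ENNReal} {φ : G → ℝ}

lemma lintegral_walkLaw (h : IsStepSet S E) (z : G) (hf : Measurable f) :
    ∫⁻ ω, f ω ∂walkLaw (Measure.dirac z) S =
      (∑ i, (∫⁻ ω, f (prepend z ω) ∂walkLaw (Measure.dirac (z + E i)) S +
        ∫⁻ ω, f (prepend z ω) ∂walkLaw (Measure.dirac (z - E i)) S)) /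
          (2 * Fintype.card ι : ℕ) := by
  have := h.isProbabilityMeasure
  simp only [lintegral_walkLaw_dirac z hf, h.lintegral_uniformOn, sub_eq_add_neg]

lemma lintegral_walkLaw_le (h : IsStepSet S E) (z : G) (hf : Measurable f) (hφ : 0 ≤ φ)
    (hle : ∀ x, ∫⁻ ω, f (prepend z ω) ∂walkLaw (Measure.dirac x) S ≤ ENNReal.ofReal (φ x)) :
    ∫⁻ ω, f ω ∂walkLaw (Measure.dirac z) S ≤ ENNReal.ofReal (stepAvg E φ z) := by
  rw [h.lintegral_walkLaw z hf, ofReal_stepAvg hφ]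
  gcongr
  exacts [hle _, hle _]

lemma le_lintegral_walkLaw (h : IsStepSet S E) (z : G) (hf : Measurable f) (hφ : 0 ≤ φ)
    (hle : ∀ x, ENNReal.ofReal (φ x) ≤ ∫⁻ ω, f (prepend z ω) ∂walkLaw (Measure.dirac x) S) :
    ENNReal.ofReal (stepAvg E φ z) ≤ ∫⁻ ω, f ω ∂walkLaw (Measure.dirac z) S := by
  rw [h.lintegral_walkLaw z hf, ofReal_stepAvg hφ]
  gcongr
  exacts [hle _, hle _]

end IsStepSet

/-! ### Unit vectors on the lattice and on the cylinder -/

lemma single_one_injective (ι R : Type*) [DecidableEq ι] [Ring R] [Nontrivial R] :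
    Function.Injective fun i : ι => (Pi.single i 1 : ι → R) := fun i k h => by
  by_contra hik
  simpa [hik] using congrFun h i

lemma single_one_ne_neg_single_one {ι R : Type*} [DecidableEq ι] [Ring R] [Nontrivial R]
    (hR : (1 : R) ≠ -1) (i k : ι) : (Pi.single i 1 : ι → R) ≠ -Pi.single k 1 := fun h => by
  have hi := congrFun h i
  by_cases hik : i = k
  · subst hik
    exact hR (by simpa using hi)
  · simp [hik] at hi

lemma mem_unitVectors_iff {ν : ℕ} {s : Fin ν → ℤ} :
    s ∈ unitVectors ν ↔ ∃ i, s = Pi.single i 1 ∨ s = -Pi.single i 1 := by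
  constructor
  · intro h
    have hsum : ∑ i, |s i| = 1 := h
    obtain ⟨i, hi⟩ : ∃ i, s i ≠ 0 := by
      by_contra! hs
      simp [hs] at hsum
    have hsplit := Finset.add_sum_erase Finset.univ (fun k => |s k|) (Finset.mem_univ i)
    have hrest : 0 ≤ ∑ k ∈ Finset.univ.erase i, |s k| := Finset.sum_nonneg fun _ _ => abs_nonneg _
    have hi1 : 1 ≤ |s i| := Int.one_le_abs hi
    have hzero : ∀ k, k ≠ i → s k = 0 := fun k hk => by
      have := (Finset.sum_eq_zero_iff_of_nonneg fun _ _ => abs_nonneg _).1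
        (show ∑ k ∈ Finset.univ.erase i, |s k| = 0 by omega) k (by simp [hk])
      simpa using this
    have hs : s = Pi.single i (s i) := by
      funext k
      by_cases hk : k = i
      · subst hk; simp
      · simp [hzero k hk, hk]
    refine ⟨i, ?_⟩
    rw [hs, ← Pi.single_neg]
    exact ((abs_eq zero_le_one).1 (by omega : |s i| = 1)).imp
      (fun h => by rw [h]) fun h => by rw [h]
  · rintro ⟨i, rfl | rfl⟩ <;> simp [unitVectors, Pi.single_apply, apply_ite abs]

lemma isStepSet_unitVectors (ν : ℕ) :
    IsStepSet (unitVectors ν) fun i : Fin ν => (Pi.single i 1 : Fin ν → ℤ) where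
  eq_union := by
    ext s
    simp only [mem_unitVectors_iff, Set.mem_union, Set.mem_range, exists_or, eq_comm]
  injective := single_one_injective _ _
  ne_neg := single_one_ne_neg_single_one (by decide)

section Coordinates

variable {d N : ℕ}

lemma proj_add (x y : Fin (d + 1) → ℤ) : proj d N (x + y) = proj d N x + proj d N y := by
  ext <;> simp [proj]

lemma proj_neg (x : Fin (d + 1) → ℤ) : proj d N (-x) = -proj d N x := by
  ext <;> simp [proj]

lemma proj_sub (x y : Fin (d + 1) → ℤ) : proj d N (x - y) = proj d N x - proj d N y := by
  rw [sub_eq_add_neg, proj_add, proj_neg, sub_eq_add_neg]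

/-- The projection to the cylinder of the `i`-th vector of the canonical basis. -/
def cylVec (d N : ℕ) (i : Fin (d + 1)) : Cylinder d N := proj d N (Pi.single i 1)

lemma cylVec_last : cylVec d N (Fin.last d) = (0, 1) := by
  ext i <;> simp [cylVec, proj, (Fin.castSucc_lt_last _).ne]

lemma cylVec_castSucc (i : Fin d) : cylVec d N i.castSucc = (Pi.single i 1, 0) := by
  ext k
  · by_cases h : k = i <;> simp [cylVec, proj, Pi.single_apply, h]
  · simp [cylVec, proj, Pi.single_apply, (Fin.castSucc_lt_last _).ne']

lemma abs_snd_add_cylVec_le (z : Cylinder d N) (i : Fin (d + 1)) :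
    |(z + cylVec d N i).2 - z.2| ≤ 1 ∧ |(z - cylVec d N i).2 - z.2| ≤ 1 := by
  refine Fin.lastCases ?_ (fun i => ?_) i
  · simp [cylVec_last]
  · simp [cylVec_castSucc]

/-- The coordinates modulo `N` of a point of the cylinder, the vertical one being the last. -/
def residue (d N : ℕ) : Cylinder d N →+ (Fin (d + 1) → ZMod N) where
  toFun z := Fin.snoc (α := fun _ => ZMod N) z.1 z.2
  map_zero' := by
    funext i
    refine Fin.lastCases ?_ (fun i => ?_) i <;> simp
  map_add' z w := by
    funext i
    refine Fin.lastCases ?_ (fun i => ?_) i <;> simp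

lemma residue_proj (x : Fin (d + 1) → ℤ) (i : Fin (d + 1)) :
    residue d N (proj d N x) i = x i := by
  refine Fin.lastCases ?_ (fun i => ?_) i <;> simp [residue, proj]

lemma residue_cylVec (i : Fin (d + 1)) : residue d N (cylVec d N i) = Pi.single i 1 := by
  funext k
  rw [cylVec, residue_proj, Pi.apply_single (fun _ => ((↑) : ℤ → ZMod N)) (by simp), Int.cast_one]

lemma isStepSet_steps (d : ℕ) (hN : 3 ≤ N) : IsStepSet (steps d N) (cylVec d N) := by
  have : Fact (1 < N) := ⟨by omega⟩
  have : Fact (2 < N) := ⟨by omega⟩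
  have hne : ∀ i, cylVec d N i ≠ 0 := fun i h => by
    simpa [residue_cylVec] using congrFun (congrArg (residue d N) h) i
  refine ⟨?_, fun i k h => ?_, fun i k h => ?_⟩
  · ext z
    simp only [steps, Set.mem_sdiff, Set.mem_image, mem_unitVectors_iff, Set.mem_singleton_iff,
      Set.mem_union, Set.mem_range]
    constructor
    · rintro ⟨⟨s, ⟨i, rfl | rfl⟩, rfl⟩, -⟩
      exacts [Or.inl ⟨i, rfl⟩, Or.inr ⟨i, (proj_neg _).symm⟩]
    · rintro (⟨i, rfl⟩ | ⟨i, rfl⟩)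
      · exact ⟨⟨_, ⟨i, Or.inl rfl⟩, rfl⟩, hne i⟩
      · exact ⟨⟨_, ⟨i, Or.inr rfl⟩, proj_neg _⟩, neg_ne_zero.2 (hne i)⟩
  · apply single_one_injective (Fin (d + 1)) (ZMod N)
    simpa only [residue_cylVec] using congrArg (residue d N) h
  · apply single_one_ne_neg_single_one (R := ZMod N) ZMod.neg_one_ne_one.symm i k
    simpa only [map_neg, residue_cylVec] using congrArg (residue d N) h

end Coordinates

/-! ### Hitting and survival probabilities -/

lemma indicator_one_nonneg {α : Type*} {F : Set α} : 0 ≤ F.indicator fun _ => (1 : ℝ) :=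
  fun z => Set.indicator_nonneg (fun _ _ => zero_le_one) z

section Hitting

variable {G ι : Type*} [AddCommGroup G] [Fintype ι]

open Classical in
/-- The probability that the walk started in `z` visits `F` at a time less than `n` before it
leaves `D`. The finite horizon reduces every estimate to the one-step recursion. -/
noncomputable def hitProb (E : ι → G) (D F : Set G) : ℕ → G → ℝ
  | 0, _ => 0
  | n + 1, z => if z ∈ D then if z ∈ F then 1 else stepAvg E (hitProb E D F n) z else 0

open Classical in
/-- The probability that the walk started in `z` is in `D` at all times less than `n`. -/
noncomputable def survProb (E : ι → G) (D : Set G) : ℕ → G → ℝ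
  | 0, _ => 1
  | n + 1, z => if z ∈ D then stepAvg E (survProb E D n) z else 0

variable {E : ι → G} {D F U : Set G} {φ : G → ℝ} {z : G} {n : ℕ}

lemma hitProb_succ_of_mem (hD : z ∈ D) (hF : z ∈ F) : hitProb E D F (n + 1) z = 1 := by
  simp [hitProb, hD, hF]

lemma hitProb_of_notMem (hD : z ∉ D) : hitProb E D F n z = 0 := by
  cases n <;> simp [hitProb, hD]

lemma hitProb_succ (hD : z ∈ D) (hF : z ∉ F) :
    hitProb E D F (n + 1) z = stepAvg E (hitProb E D F n) z := by
  simp [hitProb, hD, hF]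

lemma hitProb_nonneg (n : ℕ) : 0 ≤ hitProb E D F n := by
  induction n with
  | zero => exact le_rfl
  | succ n ih =>
    intro z
    simp only [hitProb]
    split_ifs
    exacts [zero_le_one, stepAvg_nonneg ih z, le_rfl]

lemma hitProb_le_one [Nonempty ι] (n : ℕ) (z : G) : hitProb E D F n z ≤ 1 := by
  induction n generalizing z with
  | zero => exact zero_le_one
  | succ n ih =>
    simp only [hitProb]
    split_ifs
    exacts [le_rfl, stepAvg_le_of_forall fun i => ⟨ih _, ih _⟩, zero_le_one]

lemma hitProb_mono_set [Nonempty ι] {F' : Set G} (h : F ⊆ F') (n : ℕ) :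
    hitProb E D F n ≤ hitProb E D F' n := by
  induction n with
  | zero => exact le_rfl
  | succ n ih =>
    intro z
    by_cases hD : z ∈ D
    · by_cases hF' : z ∈ F'
      · exact (hitProb_le_one _ _).trans_eq (hitProb_succ_of_mem hD hF').symm
      · rw [hitProb_succ hD hF', hitProb_succ hD fun hF => hF' (h hF)]
        exact stepAvg_mono ih z
    · rw [hitProb_of_notMem hD, hitProb_of_notMem hD]

lemma hitProb_le_succ (n : ℕ) : hitProb E D F n ≤ hitProb E D F (n + 1) := by
  induction n with
  | zero => exact hitProb_nonneg 1
  | succ n ih =>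
    intro z
    by_cases hD : z ∈ D
    · by_cases hF : z ∈ F
      · rw [hitProb_succ_of_mem hD hF, hitProb_succ_of_mem hD hF]
      · rw [hitProb_succ hD hF, hitProb_succ hD hF]
        exact stepAvg_mono ih z
    · rw [hitProb_of_notMem hD, hitProb_of_notMem hD]

lemma hitProb_le_of_superharmonic (hstep : ∀ z ∈ D, ∀ i, z + E i ∈ U ∧ z - E i ∈ U)
    (h0 : ∀ z ∈ U, 0 ≤ φ z) (h1 : ∀ z ∈ D, z ∈ F → 1 ≤ φ z)
    (h2 : ∀ z ∈ D, stepAvg E φ z ≤ φ z) (n : ℕ) (hz : z ∈ U) : hitProb E D F n z ≤ φ z := by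
  induction n generalizing z with
  | zero => exact h0 z hz
  | succ n ih =>
    simp only [hitProb]
    split_ifs with hD hF
    · exact h1 z hD hF
    · exact (stepAvg_le_stepAvg fun i => (hstep z hD i).imp ih ih).trans (h2 z hD)
    · exact h0 z hz

lemma survProb_succ (hD : z ∈ D) : survProb E D (n + 1) z = stepAvg E (survProb E D n) z := by
  simp [survProb, hD]

lemma survProb_succ_of_notMem (hD : z ∉ D) : survProb E D (n + 1) z = 0 := by
  simp [survProb, hD]

lemma survProb_nonneg (n : ℕ) : 0 ≤ survProb E D n := by
  induction n with
  | zero => exact fun _ => zero_le_one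
  | succ n ih =>
    intro z
    simp only [survProb]
    split_ifs
    exacts [stepAvg_nonneg ih z, le_rfl]

lemma survProb_le_one [Nonempty ι] (n : ℕ) (z : G) : survProb E D n z ≤ 1 := by
  induction n generalizing z with
  | zero => exact le_rfl
  | succ n ih =>
    simp only [survProb]
    split_ifs
    exacts [stepAvg_le_of_forall fun i => ⟨ih _, ih _⟩, zero_le_one]

/-- Here `φ` bounds the expected exit time from `D ∩ K`, and `ψ` the probability that this exit
takes place in `D`. -/
lemma mul_survProb_le [Nonempty ι] {K : Set G} {ψ : G → ℝ}
    (hstep : ∀ z ∈ D ∩ K, ∀ i, z + E i ∈ U ∧ z - E i ∈ U) (hφ₀ : ∀ z ∈ U, 0 ≤ φ z) (hψ₀ : 0 ≤ ψ)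
    (hψ₁ : ∀ z ∉ K, 1 ≤ ψ z) (hφ : ∀ z ∈ D ∩ K, stepAvg E φ z + 1 ≤ φ z)
    (hψ : ∀ z ∈ D ∩ K, stepAvg E ψ z ≤ ψ z) (n : ℕ) (hz : z ∈ U) :
    n * survProb E D n z ≤ φ z + n * ψ z := by
  induction n generalizing z with
  | zero => simpa using hφ₀ z hz
  | succ n ih =>
    by_cases hK : z ∈ K
    · by_cases hD : z ∈ D
      · have hle : n * stepAvg E (survProb E D n) z ≤ stepAvg E φ z + n * stepAvg E ψ z := by
          have havg := stepAvg_le_stepAvg (f := (n : ℝ) • survProb E D n) (g := φ + (n : ℝ) • ψ)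
            fun i => (hstep z ⟨hD, hK⟩ i).imp ih ih
          simpa only [map_add, map_smul, Pi.add_apply, Pi.smul_apply, smul_eq_mul] using havg
        have hone : stepAvg E (survProb E D n) z ≤ 1 := by
          simpa only [survProb_succ hD] using survProb_le_one (E := E) (D := D) (n + 1) z
        have hmul := mul_le_mul_of_nonneg_left (hψ z ⟨hD, hK⟩) n.cast_nonneg
        rw [survProb_succ hD, Nat.cast_succ, add_mul, one_mul]
        linarith [hφ z ⟨hD, hK⟩, show 0 ≤ ψ z from hψ₀ z]
      · rw [survProb_succ_of_notMem hD, mul_zero]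
        exact add_nonneg (hφ₀ z hz) (mul_nonneg (Nat.cast_nonneg _) (hψ₀ z))
    · refine le_add_of_nonneg_of_le (hφ₀ z hz) ?_
      gcongr
      exact (survProb_le_one _ z).trans (hψ₁ z hK)

lemma hitProb_le_sum_add_survProb [Nonempty ι] (L n : ℕ) (z : G) :
    hitProb E D F n z ≤
      ∑ k ∈ Finset.range L, (stepAvg E ^ k) (F.indicator fun _ => (1 : ℝ)) z +
        survProb E D L z := by
  induction L generalizing n z with
  | zero => simpa [survProb] using hitProb_le_one n z
  | succ L ih =>
    have hsum : 0 ≤ ∑ k ∈ Finset.range L, (stepAvg E ^ (k + 1)) (F.indicator fun _ => (1 : ℝ)) z :=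
      Finset.sum_nonneg fun k _ => stepAvg_pow_nonneg indicator_one_nonneg _ z
    have hsurv : 0 ≤ survProb E D (L + 1) z := survProb_nonneg _ z
    have hind : 0 ≤ F.indicator (fun _ => (1 : ℝ)) z := indicator_one_nonneg z
    rw [Finset.sum_range_succ', pow_zero, Module.End.one_apply]
    rcases n with _ | n
    · rw [hitProb]
      positivity
    by_cases hD : z ∈ D
    · by_cases hF : z ∈ F
      · rw [hitProb_succ_of_mem hD hF, Set.indicator_of_mem hF]
        linarith
      · have hrec := stepAvg_mono (E := E) (ih n) z
        rw [Set.indicator_of_notMem hF, hitProb_succ hD hF, survProb_succ hD, add_zero]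
        simpa only [stepAvg_pow_succ, ← Finset.sum_apply, ← map_sum, ← Pi.add_apply, ← map_add]
          using hrec
    · rw [hitProb_of_notMem hD]
      positivity

lemma hitProb_le_hitProb_univ_add (hφ : 0 ≤ φ) (h : ∀ n, hitProb E D F n ≤ φ)
    (M n : ℕ) (z : G) :
    hitProb E D F n z ≤ hitProb E Set.univ F M z + (stepAvg E ^ M) φ z := by
  induction M generalizing n z with
  | zero => simpa [hitProb] using h n z
  | succ M ih =>
    have hpow : 0 ≤ (stepAvg E ^ (M + 1)) φ z := stepAvg_pow_nonneg hφ _ z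
    have huniv : 0 ≤ hitProb E Set.univ F (M + 1) z := hitProb_nonneg _ z
    rcases n with _ | n
    · rw [hitProb]
      positivity
    by_cases hD : z ∈ D
    · by_cases hF : z ∈ F
      · rw [hitProb_succ_of_mem hD hF, hitProb_succ_of_mem (Set.mem_univ z) hF]
        linarith
      · rw [hitProb_succ hD hF, hitProb_succ (Set.mem_univ z) hF, stepAvg_pow_succ]
        exact (stepAvg_mono (ih n) z).trans_eq (congrFun (map_add (stepAvg E) _ _) z)
    · rw [hitProb_of_notMem hD]
      positivity

end Hitting

/-! ### The return probability on `ℤ^ν` -/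

lemma measurableSet_exists_apply_mem {G : Type*} [MeasurableSpace G] {F : Set G}
    (hF : MeasurableSet F) : MeasurableSet {ω : ℕ → G | ∃ n, ω n ∈ F} := by
  simp only [Set.ofPred_exists]
  exact MeasurableSet.iUnion fun n => measurable_pi_apply n hF

lemma IsStepSet.ofReal_hitProb_le_walkLaw {G ι : Type*} [AddCommGroup G] [Fintype ι] [Nonempty ι]
    [MeasurableSpace G] [MeasurableSingletonClass G] [MeasurableAdd₂ G] {S F : Set G} {E : ι → G}
    (h : IsStepSet S E) (hF : MeasurableSet F) (n : ℕ) (z : G) :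
    ENNReal.ofReal (hitProb E Set.univ F n z) ≤
      walkLaw (Measure.dirac z) S {ω | ∃ k, ω k ∈ F} := by
  have := h.isProbabilityMeasure
  have hA := measurableSet_exists_apply_mem hF
  have hind : Measurable ({ω : ℕ → G | ∃ k, ω k ∈ F}.indicator (1 : (ℕ → G) → ENNReal)) :=
    measurable_one.indicator hA
  induction n generalizing z with
  | zero => simp [hitProb]
  | succ n ih =>
    rw [← lintegral_indicator_one hA]
    by_cases hz : z ∈ F
    · have hone : ∀ ω, {ω : ℕ → G | ∃ k, ω k ∈ F}.indicator (1 : (ℕ → G) → ENNReal)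
          (prepend z ω) = 1 := fun ω =>
        Set.indicator_of_mem (s := {ω : ℕ → G | ∃ k, ω k ∈ F}) ⟨0, hz⟩ _
      rw [hitProb_succ_of_mem (Set.mem_univ z) hz, ← congrFun (stepAvg_const (E := E) 1) z]
      exact h.le_lintegral_walkLaw z hind (fun _ => zero_le_one) fun x => by simp [hone]
    · rw [hitProb_succ (Set.mem_univ z) hz]
      refine h.le_lintegral_walkLaw z hind (hitProb_nonneg n) fun x => (ih x).trans ?_
      rw [← lintegral_indicator_one hA]
      refine lintegral_mono fun ω => Set.indicator_apply_le' (fun ⟨k, hk⟩ => ?_) fun _ => zero_le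
      have hmem : prepend z ω ∈ {ω : ℕ → G | ∃ k, ω k ∈ F} := ⟨k + 1, hk⟩
      rw [Set.indicator_of_mem hmem]
      exact le_rfl

lemma entranceFrom_lt_top_iff {G : Type*} {U : Set G} {t : ℕ∞} {ω : ℕ → G} :
    entranceFrom U t ω < ⊤ ↔ ∃ n : ℕ, t ≤ n ∧ ω n ∈ U := by
  simp only [entranceFrom, iInf_lt_iff, exists_prop]
  exact ⟨fun ⟨n, h, _⟩ => ⟨n, h⟩, fun ⟨n, h⟩ => ⟨n, h, ENat.natCast_lt_top n⟩⟩

lemma entranceFrom_one_lt_top_iff {G : Type*} {U : Set G} {ω : ℕ → G} :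
    entranceFrom U 1 ω < ⊤ ↔ ∃ n, ω (n + 1) ∈ U := by
  rw [entranceFrom_lt_top_iff]
  constructor
  · rintro ⟨_ | n, hn, h⟩
    · simp at hn
    · exact ⟨n, h⟩
  · rintro ⟨n, h⟩
    exact ⟨n + 1, by simp, h⟩

/-- The vectors of the canonical basis of `ℤ^ν`. -/
def intVec (ν : ℕ) (i : Fin ν) : Fin ν → ℤ := Pi.single i 1

lemma stepAvg_hitProb_le_returnProb {ν : ℕ} [NeZero ν] (n : ℕ) :
    stepAvg (intVec ν) (hitProb (intVec ν) Set.univ {0} n) 0 ≤ returnProb ν := by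
  have hstep : IsStepSet (unitVectors ν) (intVec ν) := isStepSet_unitVectors ν
  have := hstep.isProbabilityMeasure
  have hmeas : MeasurableSet {ω : ℕ → Fin ν → ℤ | ∃ n, ω (n + 1) ∈ ({0} : Set (Fin ν → ℤ))} := by
    simp only [Set.ofPred_exists]
    exact MeasurableSet.iUnion fun n => measurable_pi_apply (n + 1) (measurableSet_singleton 0)
  simp only [returnProb, entranceFrom_one_lt_top_iff]
  rw [Measure.real, ← ENNReal.ofReal_le_iff_le_toReal (measure_ne_top _ _),
    ← lintegral_indicator_one hmeas]
  refine hstep.le_lintegral_walkLaw 0 (measurable_one.indicator hmeas) (hitProb_nonneg n)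
    fun x => (hstep.ofReal_hitProb_le_walkLaw (measurableSet_singleton 0) n x).trans_eq ?_
  rw [← lintegral_indicator_one (measurableSet_exists_apply_mem (measurableSet_singleton 0))]
  rfl

/-! ### Fourier analysis on the torus -/

section Torus

variable {N : ℕ} [NeZero N]

/-- The character `cos (2 π k / N)` of the discrete circle. -/
noncomputable def zcos (k : ZMod N) : ℝ := (ZMod.stdAddChar k).re

lemma zcos_eq_cos (k : ZMod N) : zcos k = Real.cos (2 * Real.pi * k.valMinAbs / N) := by
  have h : (2 * Real.pi * Complex.I * (k.valMinAbs : ℤ) / N : ℂ) =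
      ((2 * Real.pi * k.valMinAbs / N : ℝ) : ℂ) * Complex.I := by
    push_cast
    ring
  rw [zcos]
  conv_lhs => rw [← ZMod.coe_valMinAbs k]
  rw [ZMod.stdAddChar_coe, h, Complex.exp_ofReal_mul_I_re]

lemma abs_zcos_le_one (k : ZMod N) : |zcos k| ≤ 1 := by
  rw [zcos_eq_cos]
  exact Real.abs_cos_le_one _

lemma zcos_le_one (k : ZMod N) : zcos k ≤ 1 := (abs_le.1 (abs_zcos_le_one k)).2

lemma neg_one_le_zcos (k : ZMod N) : -1 ≤ zcos k := (abs_le.1 (abs_zcos_le_one k)).1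

@[simp] lemma zcos_zero : zcos (0 : ZMod N) = 1 := by simp [zcos]

lemma zcos_add_add_zcos_sub (a b : ZMod N) : zcos (a + b) + zcos (a - b) = 2 * zcos b * zcos a := by
  simp only [zcos, sub_eq_add_neg, AddChar.map_add_eq_mul, AddChar.map_neg_eq_conj,
    Complex.mul_re, Complex.conj_re, Complex.conj_im]
  ring

lemma abs_valMinAbs_le_half (k : ZMod N) : |(k.valMinAbs : ℝ)| ≤ N / 2 := by
  have h : 2 * k.valMinAbs.natAbs ≤ N := by
    have := ZMod.natAbs_valMinAbs_le k
    omega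
  have h' : (2 : ℝ) * (k.valMinAbs.natAbs : ℝ) ≤ N := by exact_mod_cast h
  rw [Nat.cast_natAbs, Int.cast_abs] at h'
  linarith

lemma sq_valMinAbs_le_one_sub_zcos (k : ZMod N) :
    8 * (|(k.valMinAbs : ℝ)| / N) ^ 2 ≤ 1 - zcos k := by
  have hN : (0 : ℝ) < N := Nat.cast_pos.2 (NeZero.pos N)
  have hangle : |2 * Real.pi * k.valMinAbs / N| ≤ Real.pi := by
    rw [abs_div, abs_mul, abs_of_pos hN, abs_of_pos Real.two_pi_pos, div_le_iff₀ hN]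
    nlinarith [Real.pi_pos, abs_valMinAbs_le_half k]
  have hcos := Real.cos_le_one_sub_mul_cos_sq hangle
  have hsq : 2 / Real.pi ^ 2 * (2 * Real.pi * k.valMinAbs / N) ^ 2 =
      8 * (|(k.valMinAbs : ℝ)| / N) ^ 2 := by
    have := Real.pi_pos.ne'
    rw [div_pow _ (N : ℝ), div_pow _ (N : ℝ), sq_abs]
    field_simp
    ring
  rw [zcos_eq_cos]
  linarith

lemma hasSum_pow_natAbs {r : ℝ} (h0 : 0 ≤ r) (h1 : r < 1) :
    HasSum (fun n : ℤ => r ^ n.natAbs) ((1 - r)⁻¹ + r * (1 - r)⁻¹) := by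
  have hgeo := hasSum_geometric_of_lt_one h0 h1
  refine HasSum.of_nat_of_neg_add_one (by simpa using hgeo) ?_
  refine (hgeo.mul_left r).congr_fun fun n => ?_
  rw [← pow_succ', Int.natAbs_neg]
  rfl

lemma sum_exp_valMinAbs_le {b : ℝ} (hb : 0 < b) :
    ∑ k : ZMod N, Real.exp (-(b * |(k.valMinAbs : ℝ)|)) ≤ 1 + 2 / b := by
  have hlt : Real.exp (-b) < 1 := Real.exp_lt_one_iff.2 (by linarith)
  have hexp : ∀ n : ℤ, Real.exp (-(b * |(n : ℝ)|)) = Real.exp (-b) ^ n.natAbs := fun n => by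
    rw [← Real.exp_nat_mul, Nat.cast_natAbs, Int.cast_abs]
    ring_nf
  have hle := sum_le_hasSum (Finset.univ.image (ZMod.valMinAbs : ZMod N → ℤ))
    (fun _ _ => by positivity) (hasSum_pow_natAbs (Real.exp_pos (-b)).le hlt)
  rw [Finset.sum_image fun _ _ _ _ h => ZMod.injective_valMinAbs h] at hle
  simp only [hexp]
  refine hle.trans ?_
  have hb1 : Real.exp (-b) * (1 + b) ≤ 1 := by
    rw [Real.exp_neg, inv_mul_le_iff₀ (Real.exp_pos b)]
    linarith [Real.add_one_le_exp b]
  have htwo : 2 * Real.exp (-b) ≤ 2 / b * (1 - Real.exp (-b)) := by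
    rw [div_mul_eq_mul_div, le_div_iff₀ hb]
    linarith
  rw [← one_add_mul, ← div_eq_mul_inv, div_le_iff₀ (by linarith)]
  linarith

variable {ι : Type*} [Fintype ι] [DecidableEq ι] {J : Finset ι}

/-- The frequencies on the torus `(ℤ/Nℤ)^ι` that vanish outside of `J`: the characters that depend
on the coordinates in `J` only. -/
def freqs (N : ℕ) [NeZero N] (J : Finset ι) : Finset (ι → ZMod N) :=
  Fintype.piFinset fun i => if i ∈ J then Finset.univ else {0}

lemma eq_zero_of_mem_freqs {ξ : ι → ZMod N} (hξ : ξ ∈ freqs N J) {i : ι} (hi : i ∉ J) :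
    ξ i = 0 := by
  simpa [hi] using Fintype.mem_piFinset.1 hξ i

lemma freqs_univ : freqs N (Finset.univ : Finset ι) = Finset.univ := by
  simp [freqs]

lemma stdAddChar_sum {κ : Type*} (s : Finset κ) (f : κ → ZMod N) :
    ZMod.stdAddChar (∑ i ∈ s, f i) = ∏ i ∈ s, ZMod.stdAddChar (f i) :=
  map_prod ZMod.stdAddChar.toMonoidHom _ _

lemma sum_freqs_zcos (J : Finset ι) (c : ι → ZMod N) :
    ∑ ξ ∈ freqs N J, zcos (∑ i, ξ i * c i) =
      if ∀ i ∈ J, c i = 0 then (N : ℝ) ^ J.card else 0 := by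
  have hcoord : ∀ i, (∑ k ∈ (if i ∈ J then Finset.univ else {0}),
      (ZMod.stdAddChar (k * c i) : ℂ)) = if i ∈ J then (if c i = 0 then (N : ℂ) else 0) else 1 := by
    intro i
    by_cases hi : i ∈ J
    · simp only [hi, if_true]
      rw [AddChar.sum_mulShift _ (ZMod.isPrimitive_stdAddChar N), ZMod.card]
      split_ifs <;> simp
    · simp [hi]
  have hprod : ∑ ξ ∈ freqs N J, (ZMod.stdAddChar (∑ i, ξ i * c i) : ℂ) =
      ∏ i ∈ J, if c i = 0 then (N : ℂ) else 0 := by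
    simp only [stdAddChar_sum, freqs]
    rw [← Finset.prod_univ_sum _ fun i k => (ZMod.stdAddChar (k * c i) : ℂ)]
    simp only [hcoord]
    rw [Finset.prod_ite_mem, Finset.univ_inter]
  simp only [zcos]
  rw [← Complex.re_sum, hprod]
  split_ifs with hc
  · rw [Finset.prod_congr rfl fun i hi => if_pos (hc i hi), Finset.prod_const]
    exact_mod_cast Complex.ofReal_re ((N : ℝ) ^ J.card)
  · push Not at hc
    obtain ⟨i, hi, hci⟩ := hc
    rw [Finset.prod_eq_zero hi (if_neg hci), Complex.zero_re]

lemma sum_freqs_exp_le (J : Finset ι) {b : ℝ} (hb : 0 < b) :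
    ∑ ξ ∈ freqs N J, Real.exp (-(b * ∑ i, |((ξ i).valMinAbs : ℝ)|)) ≤ (1 + 2 / b) ^ J.card := by
  simp only [Finset.mul_sum, ← Finset.sum_neg_distrib, Real.exp_sum, freqs]
  rw [← Finset.prod_univ_sum _ fun _ k => Real.exp (-(b * |((k : ZMod N).valMinAbs : ℝ)|)),
    ← Finset.prod_const, ← Finset.prod_subset (Finset.subset_univ J)]
  · refine Finset.prod_le_prod (fun i _ => Finset.sum_nonneg fun _ _ => (Real.exp_pos _).le) ?_
    intro i hi
    simpa [hi] using sum_exp_valMinAbs_le hb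
  · intro i _ hi
    simp [hi]

end Torus

/-! ### The heat kernel -/

section Heat

variable {N : ℕ} [NeZero N]

/-- The eigenvalue of the transition operator of simple random walk on the torus `(ℤ/Nℤ)^ι` at the
character with frequency `ξ`. -/
noncomputable def walkEigenvalue {ι : Type*} [Fintype ι] (ξ : ι → ZMod N) : ℝ :=
  (∑ i, zcos (ξ i)) / Fintype.card ι

section Eigenvalue

variable {ι : Type*} [Fintype ι] [Nonempty ι]

lemma card_mul_one_sub_walkEigenvalue (ξ : ι → ZMod N) :
    Fintype.card ι * (1 - walkEigenvalue ξ) = ∑ i, (1 - zcos (ξ i)) := by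
  have : (Fintype.card ι : ℝ) ≠ 0 := by simp
  rw [walkEigenvalue, Finset.sum_sub_distrib, Finset.sum_const, Finset.card_univ, nsmul_eq_mul,
    mul_sub, mul_div_cancel₀ _ this]

lemma abs_walkEigenvalue_le [DecidableEq ι] {J : Finset ι} (hJ : 4 * J.card ≤ 3 * Fintype.card ι)
    {ξ : ι → ZMod N} (hξ : ξ ∈ freqs N J) :
    |walkEigenvalue ξ| ≤ Real.exp (-((1 - walkEigenvalue ξ) / 4)) := by
  have hcard : (0 : ℝ) < Fintype.card ι := by simp [Fintype.card_pos]
  have hgap := card_mul_one_sub_walkEigenvalue ξ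
  have hle : walkEigenvalue ξ ≤ 1 := by
    have : 0 ≤ ∑ i, (1 - zcos (ξ i)) := Finset.sum_nonneg fun i _ => sub_nonneg.2 (zcos_le_one _)
    rw [← hgap] at this
    linarith [nonneg_of_mul_nonneg_right this hcard]
  have hge : 1 - walkEigenvalue ξ ≤ 3 / 2 := by
    have hsupp : ∑ i, (1 - zcos (ξ i)) = ∑ i ∈ J, (1 - zcos (ξ i)) := by
      refine (Finset.sum_subset (Finset.subset_univ J) fun i _ hi => ?_).symm
      rw [eq_zero_of_mem_freqs hξ hi, zcos_zero, sub_self]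
    have htwo : ∑ i ∈ J, (1 - zcos (ξ i)) ≤ J.card * 2 := by
      rw [← nsmul_eq_mul]
      exact Finset.sum_le_card_nsmul _ _ _ fun i _ => by linarith [neg_one_le_zcos (ξ i)]
    have hJ' : (4 : ℝ) * J.card ≤ 3 * Fintype.card ι := by exact_mod_cast hJ
    refine le_of_mul_le_mul_left ?_ hcard
    rw [hgap, hsupp]
    linarith
  have hexp := Real.add_one_le_exp (-((1 - walkEigenvalue ξ) / 4))
  rw [abs_le]
  constructor <;> linarith

lemma sqrt_mul_sum_valMinAbs_le (t : ℝ) (ht : 0 ≤ t) (ξ : ι → ZMod N) :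
    √(2 * t / Fintype.card ι) / N * ∑ i, |((ξ i).valMinAbs : ℝ)| ≤
      Fintype.card ι / 4 + t * ((1 - walkEigenvalue ξ) / 4) := by
  set β := √(2 * t / Fintype.card ι) / N with hβ
  have hterm : ∀ i, β * |((ξ i).valMinAbs : ℝ)| ≤
      1 / 4 + t / (4 * Fintype.card ι) * (1 - zcos (ξ i)) := by
    intro i
    have hsq : (β * |((ξ i).valMinAbs : ℝ)|) ^ 2 ≤
        t / (4 * Fintype.card ι) * (1 - zcos (ξ i)) :=
      calc (β * |((ξ i).valMinAbs : ℝ)|) ^ 2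
          = t / (4 * Fintype.card ι) * (8 * (|((ξ i).valMinAbs : ℝ)| / N) ^ 2) := by
            rw [hβ, mul_pow, div_pow, Real.sq_sqrt (by positivity)]
            field
        _ ≤ _ := by
            gcongr
            exact sq_valMinAbs_le_one_sub_zcos (ξ i)
    nlinarith [sq_nonneg (β * |((ξ i).valMinAbs : ℝ)| - 1 / 2)]
  rw [Finset.mul_sum]
  refine (Finset.sum_le_sum fun i _ => hterm i).trans_eq ?_
  rw [Finset.sum_add_distrib, ← Finset.mul_sum, ← card_mul_one_sub_walkEigenvalue,
    Finset.sum_const, Finset.card_univ, nsmul_eq_mul]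
  field

lemma abs_walkEigenvalue_pow_le [DecidableEq ι] {J : Finset ι}
    (hJ : 4 * J.card ≤ 3 * Fintype.card ι) {ξ : ι → ZMod N} (hξ : ξ ∈ freqs N J) (n : ℕ) :
    |walkEigenvalue ξ ^ n| ≤ Real.exp (Fintype.card ι / 4) *
      Real.exp (-(√(2 * n / Fintype.card ι) / N * ∑ i, |((ξ i).valMinAbs : ℝ)|)) :=
  calc |walkEigenvalue ξ ^ n|
      ≤ Real.exp (-((1 - walkEigenvalue ξ) / 4)) ^ n := by
        rw [abs_pow]
        gcongr
        exact abs_walkEigenvalue_le hJ hξ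
    _ = Real.exp (-(n * ((1 - walkEigenvalue ξ) / 4))) := by rw [← Real.exp_nat_mul, mul_neg]
    _ ≤ _ := by
        rw [← Real.exp_add, Real.exp_le_exp]
        linarith [sqrt_mul_sum_valMinAbs_le n n.cast_nonneg ξ]

lemma sum_freqs_exp_sqrt_le [DecidableEq ι] (J : Finset ι) {n : ℕ} (hn : 0 < n) :
    ∑ ξ ∈ freqs N J,
        Real.exp (-(√(2 * n / Fintype.card ι) / N * ∑ i, |((ξ i).valMinAbs : ℝ)|)) ≤
      N ^ J.card * (1 / N + 2 * Fintype.card ι / √n) ^ J.card := by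
  have hN : (0 : ℝ) < N := Nat.cast_pos.2 (NeZero.pos N)
  have hn' : (0 : ℝ) < n := Nat.cast_pos.2 hn
  have hcard : (1 : ℝ) ≤ Fintype.card ι := Nat.one_le_cast.2 Fintype.card_pos
  have hβ : 0 < √(2 * n / (Fintype.card ι : ℝ)) := by positivity
  have hsqrt : √n ≤ Fintype.card ι * √(2 * n / Fintype.card ι) := by
    refine Real.sqrt_le_iff.2 ⟨by positivity, ?_⟩
    rw [mul_pow, Real.sq_sqrt (by positivity)]
    field_simp
    nlinarith
  have hdiv : 2 / √(2 * n / (Fintype.card ι : ℝ)) ≤ 2 * Fintype.card ι / √n := by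
    rw [div_le_div_iff₀ hβ (by positivity)]
    linarith
  refine (sum_freqs_exp_le J (by positivity)).trans ?_
  rw [← mul_pow, mul_add, mul_one_div_cancel hN.ne', div_div_eq_mul_div, mul_comm 2 (N : ℝ),
    mul_div_assoc]
  exact pow_le_pow_left₀ (by positivity)
    (add_le_add_right (mul_le_mul_of_nonneg_left hdiv hN.le) 1) _

end Eigenvalue

variable {d : ℕ}

omit [NeZero N] in
lemma sum_mul_residue_cylVec (ξ : Fin (d + 1) → ZMod N) (k : Fin (d + 1)) :
    ∑ i, ξ i * residue d N (cylVec d N k) i = ξ k := by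
  simp [residue_cylVec, Pi.single_apply]

lemma stepAvg_zcos (ξ y : Fin (d + 1) → ZMod N) :
    stepAvg (cylVec d N) (fun x => zcos (∑ i, ξ i * (residue d N x i - y i))) =
      walkEigenvalue ξ • fun x => zcos (∑ i, ξ i * (residue d N x i - y i)) := by
  have hpair : ∀ z k, zcos (∑ i, ξ i * (residue d N (z + cylVec d N k) i - y i)) +
      zcos (∑ i, ξ i * (residue d N (z - cylVec d N k) i - y i)) =
      2 * zcos (ξ k) * zcos (∑ i, ξ i * (residue d N z i - y i)) := fun z k => by
    rw [← zcos_add_add_zcos_sub, ← sum_mul_residue_cylVec ξ k, ← Finset.sum_add_distrib,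
      ← Finset.sum_sub_distrib]
    congr! 3 with i - i
    · rw [map_add, Pi.add_apply]; ring
    · rw [map_sub, Pi.sub_apply]; ring
  funext z
  simp only [stepAvg_apply, hpair, ← Finset.sum_mul, ← Finset.mul_sum, walkEigenvalue,
    Pi.smul_apply, smul_eq_mul]
  field

variable {J : Finset (Fin (d + 1))} {F : Set (Cylinder d N)} {y : Fin (d + 1) → ZMod N}

lemma indicator_le_sum_freqs (hF : ∀ z ∈ F, ∀ i ∈ J, residue d N z i = y i) :
    (F.indicator fun _ => (1 : ℝ)) ≤
      (1 / (N : ℝ) ^ J.card) •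
        ∑ ξ ∈ freqs N J, fun x => zcos (∑ i, ξ i * (residue d N x i - y i)) := by
  have hN : (N : ℝ) ≠ 0 := NeZero.ne _
  intro x
  simp only [Pi.smul_apply, Finset.sum_apply, smul_eq_mul, sum_freqs_zcos]
  by_cases hx : x ∈ F
  · rw [Set.indicator_of_mem hx, if_pos fun i hi => sub_eq_zero.2 (hF x hx i hi),
      one_div_mul_cancel (pow_ne_zero _ hN)]
  · rw [Set.indicator_of_notMem hx]
    split_ifs <;> positivity

/-- The restriction on the number of coordinates keeps the eigenvalues away from `-1`. -/
lemma stepAvg_pow_indicator_le (hJ : 4 * J.card ≤ 3 * (d + 1))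
    (hF : ∀ z ∈ F, ∀ i ∈ J, residue d N z i = y i) {n : ℕ} (hn : 0 < n) (z : Cylinder d N) :
    (stepAvg (cylVec d N) ^ n) (F.indicator fun _ => (1 : ℝ)) z ≤
      Real.exp ((d + 1) / 4) * (1 / N + 2 * (d + 1) / √n) ^ J.card := by
  have hN : (0 : ℝ) < N := Nat.cast_pos.2 (NeZero.pos N)
  have hcard : (Fintype.card (Fin (d + 1)) : ℝ) = d + 1 := by simp
  have hterm : ∀ ξ ∈ freqs N J,
      walkEigenvalue ξ ^ n * zcos (∑ i, ξ i * (residue d N z i - y i)) ≤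
        Real.exp ((d + 1) / 4) *
          Real.exp (-(√(2 * n / (d + 1)) / N * ∑ i, |((ξ i).valMinAbs : ℝ)|)) := fun ξ hξ => by
    have hpow := abs_walkEigenvalue_pow_le (by simpa using hJ) hξ n
    rw [hcard] at hpow
    refine (le_abs_self _).trans ((abs_mul _ _).trans_le ?_)
    exact (mul_le_of_le_one_right (abs_nonneg _) (abs_zcos_le_one _)).trans hpow
  have hsum := sum_freqs_exp_sqrt_le (N := N) J hn
  rw [hcard] at hsum
  refine (stepAvg_pow_mono n (indicator_le_sum_freqs hF) z).trans ?_
  rw [map_smul, map_sum]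
  simp only [stepAvg_pow_of_eigen (stepAvg_zcos _ _), Pi.smul_apply, Finset.sum_apply, smul_eq_mul]
  rw [one_div_mul_eq_div, div_le_iff₀ (by positivity), mul_assoc, mul_comm _ ((N : ℝ) ^ J.card)]
  refine (Finset.sum_le_sum hterm).trans ?_
  rw [← Finset.mul_sum]
  gcongr

end Heat

/-! ### A superharmonic function on the cylinder -/

lemma stepAvg_cylVec {d N : ℕ} (f : Cylinder d N → ℝ) (z : Cylinder d N) :
    stepAvg (cylVec d N) f z =
      (∑ i, (f (z.1 + Pi.single i 1, z.2) + f (z.1 - Pi.single i 1, z.2)) +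
        (f (z.1, z.2 + 1) + f (z.1, z.2 - 1))) / (2 * (d + 1)) := by
  have hz : z = (z.1, z.2) := rfl
  rw [stepAvg_apply, Fin.sum_univ_castSucc, hz]
  simp only [cylVec_castSucc, cylVec_last, Prod.mk_add_mk, Prod.mk_sub_mk, add_zero, sub_zero,
    Fintype.card_fin, Nat.cast_succ]

lemma nonneg_of_stepAvg_le {d N : ℕ} [NeZero N] {f : Cylinder d N → ℝ} {K : ℤ}
    (hf : ∀ z, |z.2| < K → stepAvg (cylVec d N) f z ≤ f z) (hK : ∀ z, |z.2| = K → 0 ≤ f z)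
    {z : Cylinder d N} (hz : |z.2| ≤ K) : 0 ≤ f z := by
  set s : Finset (Cylinder d N) := Finset.univ ×ˢ Finset.Icc (-K) K with hs
  have hmem : ∀ w, w ∈ s ↔ |w.2| ≤ K := fun w => by simp [hs, abs_le]
  -- among the minimizers, take one of maximal height
  obtain ⟨v, hv, hmin⟩ := Finset.exists_min_image s (fun w => toLex (f w, -w.2)) ⟨z, (hmem z).2 hz⟩
  have hle : ∀ w ∈ s, f v ≤ f w := fun w hw =>
    (Prod.Lex.toLex_le_toLex.1 (hmin w hw)).elim le_of_lt fun h => h.1.le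
  rcases ((hmem v).1 hv).eq_or_lt with hvK | hvK
  · exact (hK v hvK).trans (hle z ((hmem z).2 hz))
  exfalso
  have hnbr : ∀ w : Cylinder d N, |w.2 - v.2| ≤ 1 → w ∈ s := fun w hw => by
    rw [hmem]
    have := abs_add_le (w.2 - v.2) v.2
    rw [sub_add_cancel] at this
    omega
  have hge : ∀ i, f v ≤ f (v + cylVec d N i) ∧ f v ≤ f (v - cylVec d N i) := fun i =>
    (abs_snd_add_cylVec_le v i).imp (fun h => hle _ (hnbr _ h)) fun h => hle _ (hnbr _ h)
  have hup : f v < f (v + cylVec d N (Fin.last d)) := by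
    have hlex := hmin _ (hnbr _ (abs_snd_add_cylVec_le v (Fin.last d)).1)
    simpa [Prod.Lex.toLex_le_toLex, cylVec_last] using hlex
  have hlt : f v < stepAvg (cylVec d N) f v := by
    conv_lhs => rw [← congrFun (stepAvg_const (E := cylVec d N) (f v)) v]
    rw [stepAvg_apply, stepAvg_apply]
    gcongr ?_ / _
    exact Finset.sum_lt_sum (fun i _ => add_le_add (hge i).1 (hge i).2)
      ⟨Fin.last d, Finset.mem_univ _, add_lt_add_of_lt_of_le hup (hge _).2⟩
  exact (hf v hvK).not_gt hlt

lemma abs_cast_add_one_add_abs_cast_sub_one (s : ℤ) :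
    |((s + 1 : ℤ) : ℝ)| + |((s - 1 : ℤ) : ℝ)| = 2 * |(s : ℝ)| + if s = 0 then 2 else 0 := by
  have h : |s + 1| + |s - 1| = 2 * |s| + if s = 0 then 2 else 0 := by
    simp only [abs_eq_max_neg]
    split_ifs <;> omega
  exact_mod_cast h

lemma pow_natAbs_add_one_add_pow_natAbs_sub_one {r c : ℝ} (hr : r ^ 2 + 1 = 2 * c * r) (s : ℤ) :
    r ^ (s + 1).natAbs + r ^ (s - 1).natAbs =
      2 * c * r ^ s.natAbs - if s = 0 then 2 * (c - r) else 0 := by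
  rcases lt_trichotomy s 0 with hs | rfl | hs
  · obtain ⟨k, rfl⟩ : ∃ k : ℕ, s = -(k + 1 : ℕ) := ⟨s.natAbs - 1, by omega⟩
    rw [if_neg hs.ne, show (-((k + 1 : ℕ) : ℤ) + 1).natAbs = k by omega,
      show (-((k + 1 : ℕ) : ℤ) - 1).natAbs = k + 2 by omega,
      show (-((k + 1 : ℕ) : ℤ)).natAbs = k + 1 by omega]
    linear_combination r ^ k * hr
  · norm_num
    ring
  · obtain ⟨k, rfl⟩ : ∃ k : ℕ, s = (k + 1 : ℕ) := ⟨s.natAbs - 1, by omega⟩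
    rw [if_neg hs.ne', show (((k + 1 : ℕ) : ℤ) + 1).natAbs = k + 2 by omega,
      show (((k + 1 : ℕ) : ℤ) - 1).natAbs = k by omega,
      show ((k + 1 : ℕ) : ℤ).natAbs = k + 1 by omega]
    linear_combination r ^ k * hr

section Green

variable {d N : ℕ} [NeZero N]

/-- The eigenvalue at frequency `ξ` of (minus one half of) the horizontal Laplacian. -/
noncomputable def lapEig (ξ : Fin d → ZMod N) : ℝ := ∑ i, (1 - zcos (ξ i))

/-- `sinh θ`, where `cosh θ = 1 + lapEig ξ`: the functions `s ↦ exp (± θ s)` are the vertical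
factors of the harmonic functions with horizontal frequency `ξ`. -/
noncomputable def decaySinh (ξ : Fin d → ZMod N) : ℝ := √(lapEig ξ ^ 2 + 2 * lapEig ξ)

/-- `exp (-θ)`, where `cosh θ = 1 + lapEig ξ`. -/
noncomputable def decayRatio (ξ : Fin d → ZMod N) : ℝ := 1 + lapEig ξ - decaySinh ξ

/-- The vertical factor of the Green function at frequency `ξ`. The frequency zero, at which the
decaying solution degenerates, gets the recurrent potential kernel shifted by `L`. -/
noncomputable def profile (L : ℝ) (ξ : Fin d → ZMod N) (s : ℤ) : ℝ :=
  if ξ = 0 then L - |(s : ℝ)| else decayRatio ξ ^ s.natAbs / decaySinh ξ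

/-- The component of the Green function at frequency `ξ`. -/
noncomputable def greenMode (L : ℝ) (ξ : Fin d → ZMod N) (z : Cylinder d N) : ℝ :=
  zcos (∑ i, ξ i * z.1 i) * profile L ξ z.2

/-- A function whose discrete Laplacian is a unit mass at the origin of the cylinder, given by its
Fourier series; it plays the role of a Green function where it is nonnegative. -/
noncomputable def greenFun (L : ℝ) (z : Cylinder d N) : ℝ :=
  (d + 1) / (N : ℝ) ^ d * ∑ ξ : Fin d → ZMod N, greenMode L ξ z

lemma lapEig_nonneg (ξ : Fin d → ZMod N) : 0 ≤ lapEig ξ :=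
  Finset.sum_nonneg fun _ _ => sub_nonneg.2 (zcos_le_one _)

lemma lapEig_le (ξ : Fin d → ZMod N) : lapEig ξ ≤ 2 * d := by
  have : lapEig ξ ≤ Fintype.card (Fin d) • (2 : ℝ) :=
    Finset.sum_le_card_nsmul _ _ _ fun i _ => by linarith [neg_one_le_zcos (ξ i)]
  rwa [Fintype.card_fin, nsmul_eq_mul, mul_comm] at this

lemma sq_decaySinh (ξ : Fin d → ZMod N) : decaySinh ξ ^ 2 = lapEig ξ ^ 2 + 2 * lapEig ξ :=
  Real.sq_sqrt (by have := lapEig_nonneg ξ; positivity)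

lemma decaySinh_nonneg (ξ : Fin d → ZMod N) : 0 ≤ decaySinh ξ := Real.sqrt_nonneg _

lemma valMinAbs_le_decaySinh (ξ : Fin d → ZMod N) (i : Fin d) :
    4 * |((ξ i).valMinAbs : ℝ)| / N ≤ decaySinh ξ := by
  have hlap : 1 - zcos (ξ i) ≤ lapEig ξ :=
    Finset.single_le_sum (f := fun i => 1 - zcos (ξ i))
      (fun k _ => sub_nonneg.2 (zcos_le_one _)) (Finset.mem_univ i)
  refine Real.le_sqrt_of_sq_le ?_
  calc (4 * |((ξ i).valMinAbs : ℝ)| / N) ^ 2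
      = 2 * (8 * (|((ξ i).valMinAbs : ℝ)| / N) ^ 2) := by ring
    _ ≤ _ := by nlinarith [sq_nonneg (lapEig ξ), sq_valMinAbs_le_one_sub_zcos (ξ i)]

lemma four_div_le_decaySinh {ξ : Fin d → ZMod N} (hξ : ξ ≠ 0) : 4 / N ≤ decaySinh ξ := by
  obtain ⟨i, hi⟩ := Function.ne_iff.1 hξ
  refine le_trans ?_ (valMinAbs_le_decaySinh ξ i)
  have hone : (1 : ℝ) ≤ |((ξ i).valMinAbs : ℝ)| := by
    exact_mod_cast Int.one_le_abs (mt (ZMod.valMinAbs_eq_zero _).1 hi)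
  gcongr
  linarith

lemma decaySinh_pos {ξ : Fin d → ZMod N} (hξ : ξ ≠ 0) : 0 < decaySinh ξ := by
  have hN : (0 : ℝ) < N := Nat.cast_pos.2 (NeZero.pos N)
  exact lt_of_lt_of_le (by positivity) (four_div_le_decaySinh hξ)

lemma decayRatio_mul (ξ : Fin d → ZMod N) : decayRatio ξ * (1 + lapEig ξ + decaySinh ξ) = 1 := by
  rw [decayRatio]
  linear_combination -sq_decaySinh ξ

lemma sq_decayRatio_add_one (ξ : Fin d → ZMod N) :
    decayRatio ξ ^ 2 + 1 = 2 * (1 + lapEig ξ) * decayRatio ξ := by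
  rw [decayRatio]
  linear_combination sq_decaySinh ξ

lemma decayRatio_pos (ξ : Fin d → ZMod N) : 0 < decayRatio ξ :=
  pos_of_mul_pos_left ((decayRatio_mul ξ).symm ▸ one_pos)
    (by linarith [lapEig_nonneg ξ, decaySinh_nonneg ξ])

lemma decayRatio_le_exp (ξ : Fin d → ZMod N) :
    decayRatio ξ ≤ Real.exp (-(decaySinh ξ / (2 * d + 2))) := by
  have hlap := lapEig_nonneg ξ
  have hsinh := decaySinh_nonneg ξ
  have hsinh' : decaySinh ξ ≤ 2 * d + 1 := by nlinarith [lapEig_le ξ, sq_decaySinh ξ]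
  calc decayRatio ξ ≤ 1 / (1 + decaySinh ξ) := by
        rw [le_div_iff₀ (by linarith)]
        nlinarith [decayRatio_mul ξ, mul_nonneg (decayRatio_pos ξ).le hlap]
    _ = -(decaySinh ξ / (1 + decaySinh ξ)) + 1 := by
        field_simp
        ring
    _ ≤ Real.exp (-(decaySinh ξ / (1 + decaySinh ξ))) := Real.add_one_le_exp _
    _ ≤ _ := by
        gcongr Real.exp (-(_ / ?_))
        linarith

lemma decayRatio_pow_le (hd : 0 < d) (ξ : Fin d → ZMod N) {n : ℕ} (hn : (N : ℝ) / 4 ≤ n) :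
    decayRatio ξ ^ n ≤
      Real.exp (-(1 / (2 * d * (d + 1)) * ∑ i, |((ξ i).valMinAbs : ℝ)|)) := by
  have hN : (0 : ℝ) < N := Nat.cast_pos.2 (NeZero.pos N)
  have hd' : (0 : ℝ) < d := Nat.cast_pos.2 hd
  have hsum : 4 * ∑ i, |((ξ i).valMinAbs : ℝ)| ≤ d * decaySinh ξ * N := by
    have := Finset.sum_le_sum fun i (_ : i ∈ Finset.univ) => valMinAbs_le_decaySinh ξ i
    rwa [Finset.sum_const, Finset.card_univ, Fintype.card_fin, nsmul_eq_mul, ← Finset.sum_div,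
      ← Finset.mul_sum, div_le_iff₀ hN] at this
  have hsum' : ∑ i, |((ξ i).valMinAbs : ℝ)| ≤ d * (n * decaySinh ξ) := by
    nlinarith [mul_le_mul_of_nonneg_right hn (mul_nonneg hd'.le (decaySinh_nonneg ξ))]
  refine (pow_le_pow_left₀ (decayRatio_pos ξ).le (decayRatio_le_exp ξ) n).trans ?_
  rw [← Real.exp_nat_mul, Real.exp_le_exp, mul_neg, neg_le_neg_iff]
  calc 1 / (2 * d * (d + 1)) * ∑ i, |((ξ i).valMinAbs : ℝ)|
      ≤ 1 / (2 * d * (d + 1)) * (d * (n * decaySinh ξ)) := by gcongr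
    _ = n * (decaySinh ξ / (2 * d + 2)) := by field

lemma profile_add_one_add_profile_sub_one (L : ℝ) (ξ : Fin d → ZMod N) (s : ℤ) :
    profile L ξ (s + 1) + profile L ξ (s - 1) =
      2 * (1 + lapEig ξ) * profile L ξ s - if s = 0 then 2 else 0 := by
  by_cases hξ : ξ = 0
  · have hlap : lapEig ξ = 0 := by simp [lapEig, hξ]
    simp only [profile, hξ, if_true, hξ ▸ hlap]
    linear_combination -abs_cast_add_one_add_abs_cast_sub_one s
  · have hpow := pow_natAbs_add_one_add_pow_natAbs_sub_one (sq_decayRatio_add_one ξ) s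
    have hsinh := (decaySinh_pos hξ).ne'
    have hsub : 1 + lapEig ξ - decayRatio ξ = decaySinh ξ := by
      rw [decayRatio]
      ring
    simp only [profile, hξ, if_false]
    rw [← add_div, hpow, hsub, sub_div, mul_div_assoc]
    split_ifs
    · rw [mul_div_cancel_right₀ _ hsinh]
    · rw [zero_div]

lemma zcos_add_single_add_zcos_sub_single (ξ h : Fin d → ZMod N) (k : Fin d) :
    zcos (∑ i, ξ i * (h + Pi.single k 1 : Fin d → ZMod N) i) +
        zcos (∑ i, ξ i * (h - Pi.single k 1 : Fin d → ZMod N) i) =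
      2 * zcos (ξ k) * zcos (∑ i, ξ i * h i) := by
  rw [← zcos_add_add_zcos_sub]
  simp [mul_add, mul_sub, Finset.sum_add_distrib, Finset.sum_sub_distrib, Pi.single_apply]

lemma stepAvg_greenMode (L : ℝ) (ξ : Fin d → ZMod N) (z : Cylinder d N) :
    stepAvg (cylVec d N) (greenMode L ξ) z = greenMode L ξ z -
      (if z.2 = 0 then 1 / (d + 1 : ℝ) else 0) * zcos (∑ i, ξ i * z.1 i) := by
  have hcos : ∑ k, zcos (ξ k) = d - lapEig ξ := by simp [lapEig]
  simp only [stepAvg_cylVec, greenMode, ← add_mul, ← mul_add, zcos_add_single_add_zcos_sub_single,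
    profile_add_one_add_profile_sub_one, ← Finset.sum_mul, ← Finset.mul_sum, hcos]
  split_ifs <;> field

lemma stepAvg_greenFun (L : ℝ) (z : Cylinder d N) :
    stepAvg (cylVec d N) (greenFun L) z = greenFun L z - if z = 0 then 1 else 0 := by
  have hN : (N : ℝ) ≠ 0 := NeZero.ne _
  have hcos := sum_freqs_zcos (N := N) Finset.univ z.1
  rw [freqs_univ, Finset.card_univ, Fintype.card_fin] at hcos
  have hfun : (greenFun L : Cylinder d N → ℝ) = ((d + 1) / (N : ℝ) ^ d) • ∑ ξ, greenMode L ξ := by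
    funext z
    simp [greenFun]
  have hz : z = 0 ↔ z.2 = 0 ∧ ∀ i ∈ Finset.univ, z.1 i = 0 := by
    rw [Prod.ext_iff, funext_iff]
    simp [and_comm]
  rw [hfun, map_smul, map_sum]
  simp only [Pi.smul_apply, Finset.sum_apply, stepAvg_greenMode, Finset.sum_sub_distrib,
    ← Finset.mul_sum, hcos, hz, ite_and, smul_eq_mul]
  split_ifs <;> field

lemma sum_greenFun (L : ℝ) (s : ℤ) :
    ∑ h : Fin d → ZMod N, greenFun L (h, s) = (d + 1) * (L - |(s : ℝ)|) := by
  have hN : (N : ℝ) ≠ 0 := NeZero.ne _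
  have hmode : ∀ ξ : Fin d → ZMod N, ∑ h : Fin d → ZMod N, greenMode L ξ (h, s) =
      if ξ = 0 then (N : ℝ) ^ d * (L - |(s : ℝ)|) else 0 := fun ξ => by
    have hcos := sum_freqs_zcos (N := N) Finset.univ ξ
    have hiff : (∀ i ∈ Finset.univ, ξ i = 0) ↔ ξ = 0 := by simp [funext_iff]
    simp only [freqs_univ, Finset.card_univ, Fintype.card_fin, hiff] at hcos
    simp only [greenMode, ← Finset.sum_mul, mul_comm (ξ _), hcos, ite_mul, zero_mul]
    split_ifs with hξ
    · rw [profile, if_pos hξ]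
    · rfl
  simp only [greenFun]
  rw [← Finset.mul_sum, Finset.sum_comm]
  simp only [hmode]
  rw [Finset.sum_ite_eq' Finset.univ (0 : Fin d → ZMod N), if_pos (Finset.mem_univ _)]
  field

/-- The constant in the bound for the contribution of the non-zero frequencies to `greenFun`. -/
noncomputable def freqConst (d : ℕ) : ℝ := (1 + 2 / (1 / (2 * d * (d + 1)))) ^ d

lemma freqConst_pos (d : ℕ) : 0 < freqConst d := by
  unfold freqConst
  positivity

lemma abs_greenMode_le (hd : 0 < d) (L : ℝ) {ξ : Fin d → ZMod N} (hξ : ξ ≠ 0) {z : Cylinder d N}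
    (hz : (N : ℝ) / 4 ≤ |(z.2 : ℝ)|) :
    |greenMode L ξ z| ≤
      Real.exp (-(1 / (2 * d * (d + 1)) * ∑ i, |((ξ i).valMinAbs : ℝ)|)) * N := by
  have hN : (0 : ℝ) < N := Nat.cast_pos.2 (NeZero.pos N)
  have hsinh := decaySinh_pos hξ
  have hone : 1 ≤ N * decaySinh ξ := by
    have := four_div_le_decaySinh hξ
    rw [div_le_iff₀ hN] at this
    linarith
  have hpow : decayRatio ξ ^ z.2.natAbs ≤ _ := decayRatio_pow_le hd ξ <| by
    rwa [Nat.cast_natAbs, Int.cast_abs]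
  have hnonneg : 0 ≤ decayRatio ξ ^ z.2.natAbs / decaySinh ξ :=
    div_nonneg (pow_nonneg (decayRatio_pos ξ).le _) hsinh.le
  rw [greenMode, profile, if_neg hξ, abs_mul, abs_of_nonneg hnonneg]
  refine (mul_le_of_le_one_left hnonneg (abs_zcos_le_one _)).trans ?_
  rw [div_le_iff₀ hsinh, mul_assoc]
  exact hpow.trans (le_mul_of_one_le_right (Real.exp_pos _).le hone)

lemma abs_greenFun_sub_le (hd : 0 < d) (L : ℝ) {z : Cylinder d N}
    (hz : (N : ℝ) / 4 ≤ |(z.2 : ℝ)|) :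
    |greenFun L z - (d + 1) / (N : ℝ) ^ d * (L - |(z.2 : ℝ)|)| ≤
      (d + 1) / (N : ℝ) ^ d * (freqConst d * N) := by
  have hN : (0 : ℝ) < N := Nat.cast_pos.2 (NeZero.pos N)
  have : (0 : ℝ) < d := Nat.cast_pos.2 hd
  have hzero : greenMode L (0 : Fin d → ZMod N) z = L - |(z.2 : ℝ)| := by
    simp [greenMode, profile]
  have hexp := sum_freqs_exp_le (N := N) (Finset.univ : Finset (Fin d))
    (show (0 : ℝ) < 1 / (2 * d * (d + 1)) by positivity)
  rw [freqs_univ, Finset.card_univ, Fintype.card_fin, ← freqConst] at hexp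
  rw [greenFun, ← mul_sub, ← Finset.add_sum_erase _ _ (Finset.mem_univ (0 : Fin d → ZMod N)),
    hzero, add_sub_cancel_left, abs_mul, abs_of_nonneg (by positivity)]
  gcongr
  calc |∑ ξ ∈ Finset.univ.erase (0 : Fin d → ZMod N), greenMode L ξ z|
      ≤ ∑ ξ ∈ Finset.univ.erase (0 : Fin d → ZMod N), |greenMode L ξ z| :=
        Finset.abs_sum_le_sum_abs _ _
    _ ≤ ∑ ξ ∈ Finset.univ.erase (0 : Fin d → ZMod N),
        Real.exp (-(1 / (2 * d * (d + 1)) * ∑ i, |((ξ i).valMinAbs : ℝ)|)) * N :=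
        Finset.sum_le_sum fun ξ hξ => abs_greenMode_le hd L (Finset.mem_erase.1 hξ).1 hz
    _ ≤ ∑ ξ : Fin d → ZMod N,
        Real.exp (-(1 / (2 * d * (d + 1)) * ∑ i, |((ξ i).valMinAbs : ℝ)|)) * N :=
        Finset.sum_le_sum_of_subset_of_nonneg (Finset.erase_subset _ _) fun _ _ _ => by positivity
    _ ≤ freqConst d * N := by
        rw [← Finset.sum_mul]
        gcongr

/-- The shift `L` for which `greenFun L` is nonnegative at all heights up to `3 * N`. -/
noncomputable def greenHeight (d N : ℕ) : ℝ := (freqConst d + 3) * N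

lemma greenFun_le_of_le (hd : 0 < d) {z : Cylinder d N} (hz : (N : ℝ) / 4 ≤ |(z.2 : ℝ)|) :
    greenFun (greenHeight d N) z ≤ (d + 1) * (2 * freqConst d + 3) * (N / (N : ℝ) ^ d) := by
  have hle := (abs_le.1 (abs_greenFun_sub_le hd (greenHeight d N) hz)).2
  calc greenFun (greenHeight d N) z
      ≤ (d + 1) / (N : ℝ) ^ d * (greenHeight d N - |(z.2 : ℝ)|) +
          (d + 1) / (N : ℝ) ^ d * (freqConst d * N) := by linarith
    _ ≤ (d + 1) / (N : ℝ) ^ d * greenHeight d N + (d + 1) / (N : ℝ) ^ d * (freqConst d * N) := by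
        gcongr
        linarith [abs_nonneg (z.2 : ℝ)]
    _ = _ := by
        rw [greenHeight]
        ring

lemma greenFun_nonneg (hd : 0 < d) {z : Cylinder d N} (hz : |z.2| ≤ 3 * N) :
    0 ≤ greenFun (greenHeight d N) z := by
  refine nonneg_of_stepAvg_le (fun w _ => ?_) (fun w hw => ?_) hz
  · rw [stepAvg_greenFun]
    split_ifs <;> linarith
  · have hw' : |(w.2 : ℝ)| = 3 * N := by exact_mod_cast hw
    have hlow := (abs_le.1 (abs_greenFun_sub_le hd (greenHeight d N)
      (show (N : ℝ) / 4 ≤ |(w.2 : ℝ)| by linarith [N.cast_nonneg (α := ℝ)]))).1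
    rw [hw', show greenHeight d N - 3 * N = freqConst d * N by rw [greenHeight]; ring] at hlow
    linarith

lemma one_le_greenFun_zero (hd : 0 < d) : 1 ≤ greenFun (greenHeight d N) (0 : Cylinder d N) := by
  have hN : (1 : ℤ) ≤ N := Nat.one_le_cast.2 (NeZero.one_le)
  have hnonneg : ∀ x : Cylinder d N, |x.2 - (0 : Cylinder d N).2| ≤ 1 →
      0 ≤ greenFun (greenHeight d N) x := fun x hx => greenFun_nonneg hd <| by
    rw [Prod.snd_zero, sub_zero] at hx
    linarith
  have havg : 0 ≤ stepAvg (cylVec d N) (greenFun (greenHeight d N)) 0 := by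
    rw [← congrFun (stepAvg_const (E := cylVec d N) 0) 0]
    exact stepAvg_le_stepAvg fun i =>
      (abs_snd_add_cylVec_le (0 : Cylinder d N) i).imp (hnonneg _) (hnonneg _)
  rw [stepAvg_greenFun, if_pos rfl] at havg
  linarith

end Green

/-! ### Returns to a lattice section -/

section OuterBlock

variable {d N : ℕ} {j : ℤ} {z : Cylinder d N}

lemma abs_snd_sub_le_of_mem_outerBlock (hz : z ∈ outerBlock d N j) :
    |z.2 - j * N| ≤ 2 * N - 1 := by
  have h : (j - 2) * N + 1 ≤ z.2 ∧ z.2 ≤ (j + 2) * N - 1 := hz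
  rw [abs_le]
  constructor <;> linarith

lemma abs_snd_add_cylVec_sub_le (hz : z ∈ outerBlock d N j) (i : Fin (d + 1)) :
    |(z + cylVec d N i).2 - j * N| ≤ 2 * N ∧ |(z - cylVec d N i).2 - j * N| ≤ 2 * N := by
  have hle := abs_snd_sub_le_of_mem_outerBlock hz
  exact (abs_snd_add_cylVec_le z i).imp (fun h => (abs_sub_le _ z.2 _).trans (by linarith))
    fun h => (abs_sub_le _ z.2 _).trans (by linarith)

lemma stepAvg_quadratic (a c : ℝ) (z : Cylinder d N) :
    stepAvg (cylVec d N) (fun w => (d + 1) * (c - ((w.2 : ℝ) - a) ^ 2)) z + 1 =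
      (d + 1) * (c - ((z.2 : ℝ) - a) ^ 2) := by
  simp only [stepAvg_cylVec, Finset.sum_const, Finset.card_univ, Fintype.card_fin, nsmul_eq_mul,
    Int.cast_add, Int.cast_sub, Int.cast_one]
  field

lemma quadratic_nonneg {a b : ℝ} (hz : |(z.2 : ℝ) - a| ≤ b) :
    0 ≤ (d + 1) * (b ^ 2 - ((z.2 : ℝ) - a) ^ 2) :=
  mul_nonneg (by positivity) (sub_nonneg.2 (sq_le_sq' (abs_le.1 hz).1 (abs_le.1 hz).2))

lemma mul_survProb_outerBlock_le (j : ℤ) (n : ℕ) (z : Cylinder d N) :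
    n * survProb (cylVec d N) (outerBlock d N j) n z ≤ 4 * (d + 1) * (N : ℝ) ^ 2 := by
  rcases n with _ | n
  · rw [Nat.cast_zero, zero_mul]
    positivity
  by_cases hz : z ∈ outerBlock d N j
  · have hle := mul_survProb_le (E := cylVec d N) (D := outerBlock d N j) (K := Set.univ) (ψ := 0)
      (U := {w : Cylinder d N | |w.2 - j * N| ≤ 2 * N})
      (φ := fun w => (d + 1) * ((2 * N : ℝ) ^ 2 - ((w.2 : ℝ) - j * N) ^ 2))
      (fun w hw i => abs_snd_add_cylVec_sub_le hw.1 i)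
      (fun w (hw : |w.2 - j * N| ≤ 2 * N) => quadratic_nonneg (by exact_mod_cast hw)) le_rfl
      (fun w hw => absurd (Set.mem_univ w) hw) (fun w _ => (stepAvg_quadratic _ _ w).le)
      (fun w _ => by rw [map_zero]) (n + 1)
      (show |z.2 - j * N| ≤ 2 * N by linarith [abs_snd_sub_le_of_mem_outerBlock hz])
    have : 0 ≤ (d + 1 : ℝ) * ((z.2 : ℝ) - j * N) ^ 2 := by positivity
    rw [Pi.zero_apply, mul_zero, add_zero] at hle
    linarith
  · rw [survProb_succ_of_notMem hz, mul_zero]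
    positivity

lemma stepAvg_pow_survProb_outerBlock_le (j : ℤ) (k : ℕ) {n : ℕ} (hn : 0 < n) (z : Cylinder d N) :
    (stepAvg (cylVec d N) ^ k) (survProb (cylVec d N) (outerBlock d N j) n) z ≤
      4 * (d + 1) * (N : ℝ) ^ 2 / n := by
  rw [← congrFun (stepAvg_pow_const (E := cylVec d N) (4 * (d + 1) * (N : ℝ) ^ 2 / n) k) z]
  refine stepAvg_pow_mono k (fun x => ?_) z
  rw [le_div_iff₀' (Nat.cast_pos.2 hn)]
  exact mul_survProb_outerBlock_le j n x

end OuterBlock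

section Transverse

variable {d m : ℕ} {I : Finset (Fin (d + 1))} (hI : Iᶜ.card = d + 1 - m) (y : Fin (d + 1) → ℤ)

/-- The coordinates of `x - y` outside of `I`. -/
def transverse (x : Fin (d + 1) → ℤ) (a : Fin (d + 1 - m)) : ℤ :=
  x (Iᶜ.orderEmbOfFin hI a) - y (Iᶜ.orderEmbOfFin hI a)

lemma orderEmbOfFin_compl_notMem (a : Fin (d + 1 - m)) : Iᶜ.orderEmbOfFin hI a ∉ I :=
  Finset.mem_compl.1 (Finset.orderEmbOfFin_mem Iᶜ hI a)

lemma transverse_add_intVec_of_mem (x : Fin (d + 1) → ℤ) {k : Fin (d + 1)} (hk : k ∈ I) :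
    transverse hI y (x + intVec (d + 1) k) = transverse hI y x ∧
      transverse hI y (x - intVec (d + 1) k) = transverse hI y x := by
  have hne : ∀ a, Iᶜ.orderEmbOfFin hI a ≠ k := fun a h =>
    orderEmbOfFin_compl_notMem hI a (h ▸ hk)
  constructor <;> funext a <;> simp [transverse, intVec, hne a]

lemma transverse_add_intVec_orderEmbOfFin (x : Fin (d + 1) → ℤ) (a : Fin (d + 1 - m)) :
    transverse hI y (x + intVec (d + 1) (Iᶜ.orderEmbOfFin hI a)) =
        transverse hI y x + intVec (d + 1 - m) a ∧
      transverse hI y (x - intVec (d + 1) (Iᶜ.orderEmbOfFin hI a)) =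
        transverse hI y x - intVec (d + 1 - m) a := by
  constructor <;> funext b <;>
    simp only [transverse, intVec, Pi.add_apply, Pi.sub_apply, Pi.single_apply,
      EmbeddingLike.apply_eq_iff_eq] <;> ring

lemma stepAvg_comp_transverse (hm : m ≤ d) (f : (Fin (d + 1 - m) → ℤ) → ℝ)
    (x : Fin (d + 1) → ℤ) :
    stepAvg (intVec (d + 1)) (f ∘ transverse hI y) x =
      (m : ℝ) / (d + 1) * f (transverse hI y x) +
        (1 - (m : ℝ) / (d + 1)) * stepAvg (intVec (d + 1 - m)) f (transverse hI y x) := by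
  have hcard : I.card = m := by
    have := Finset.card_add_card_compl I
    rw [hI, Fintype.card_fin] at this
    omega
  have hmem : ∀ k ∈ I, f (transverse hI y (x + intVec (d + 1) k)) +
      f (transverse hI y (x - intVec (d + 1) k)) = 2 * f (transverse hI y x) := fun k hk => by
    rw [(transverse_add_intVec_of_mem hI y x hk).1, (transverse_add_intVec_of_mem hI y x hk).2,
      two_mul]
  have hcompl : ∑ k ∈ Iᶜ, (f (transverse hI y (x + intVec (d + 1) k)) +
      f (transverse hI y (x - intVec (d + 1) k))) =
      ∑ a, (f (transverse hI y x + intVec (d + 1 - m) a) +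
        f (transverse hI y x - intVec (d + 1 - m) a)) := by
    conv_lhs => rw [← Finset.map_orderEmbOfFin_univ Iᶜ hI, Finset.sum_map]
    refine Finset.sum_congr rfl fun a _ => ?_
    obtain ⟨hadd, hsub⟩ := transverse_add_intVec_orderEmbOfFin hI y x a
    rw [RelEmbedding.coe_toEmbedding, hadd, hsub]
  have hν : ((d + 1 - m : ℕ) : ℝ) = d + 1 - m := by
    rw [Nat.cast_sub (by omega), Nat.cast_succ]
  have hν0 : (d + 1 - m : ℝ) ≠ 0 := by
    rw [← hν]
    exact Nat.cast_ne_zero.2 (by omega)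
  simp only [stepAvg_apply, Fintype.card_fin, Function.comp_apply]
  rw [← Finset.sum_add_sum_compl I, hcompl, Finset.sum_congr rfl hmem, Finset.sum_const, hcard,
    nsmul_eq_mul, hν, Nat.cast_succ]
  field

lemma stepAvg_cylVec_proj {N : ℕ} (f : Cylinder d N → ℝ) (x : Fin (d + 1) → ℤ) :
    stepAvg (cylVec d N) f (proj d N x) = stepAvg (intVec (d + 1)) (f ∘ proj d N) x := by
  simp only [stepAvg_apply, Function.comp_apply, proj_add, proj_sub]
  rfl

lemma abs_intVec_le (ν : ℕ) (k i : Fin ν) : |intVec ν k i| ≤ 1 := by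
  simp only [intVec, Pi.single_apply]
  split_ifs <;> simp

lemma transverse_eq_zero {N : ℕ} {x : Fin (d + 1) → ℤ} (hx : ∀ i ∉ I, |x i - y i| < N)
    (hF : proj d N x ∈ proj d N '' {x | ∀ i, i ∉ I → x i = y i}) : transverse hI y x = 0 := by
  obtain ⟨w, hw, hwx⟩ := hF
  funext a
  have ha := orderEmbOfFin_compl_notMem hI a
  have hcast : ((x (Iᶜ.orderEmbOfFin hI a) : ℤ) : ZMod N) = (y (Iᶜ.orderEmbOfFin hI a) : ℤ) := by
    rw [← residue_proj, ← hwx, residue_proj, hw _ ha]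
  exact Int.eq_zero_of_abs_lt_dvd ((ZMod.intCast_eq_intCast_iff_dvd_sub _ _ N).1 hcast.symm)
    (hx _ ha)

/-- Before the walk can wrap around the torus, it sees only one copy of the section. -/
lemma hitProb_proj_le {N : ℕ} (hm : m ≤ d) (k : ℕ) {x : Fin (d + 1) → ℤ}
    (hx : ∀ i ∉ I, |x i - y i| + k ≤ N) :
    hitProb (cylVec d N) Set.univ (proj d N '' {x | ∀ i, i ∉ I → x i = y i}) k (proj d N x) ≤
      hitProb (intVec (d + 1 - m)) Set.univ {0} k (transverse hI y x) := by
  have : NeZero (d + 1 - m) := ⟨by omega⟩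
  induction k generalizing x with
  | zero => exact le_rfl
  | succ k ih =>
    push_cast at hx
    by_cases h0 : transverse hI y x ∈ ({0} : Set (Fin (d + 1 - m) → ℤ))
    · exact (hitProb_le_one _ _).trans_eq (hitProb_succ_of_mem (Set.mem_univ _) h0).symm
    have hF : proj d N x ∉ proj d N '' {x | ∀ i, i ∉ I → x i = y i} := fun hF =>
      h0 (transverse_eq_zero hI y (fun i hi => by linarith [hx i hi]) hF)
    have hnbr : ∀ s : Fin (d + 1) → ℤ, (∀ i, |s i - x i| ≤ 1) → ∀ i ∉ I, |s i - y i| + k ≤ N :=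
      fun s hs i hi => by linarith [hx i hi, hs i, abs_sub_le (s i) (x i) (y i)]
    rw [hitProb_succ (Set.mem_univ _) hF, stepAvg_cylVec_proj]
    refine (stepAvg_le_stepAvg (g := hitProb (intVec (d + 1 - m)) Set.univ {0} k ∘ transverse hI y)
      fun i => ⟨ih (hnbr _ fun l => by simpa using abs_intVec_le (d + 1) i l),
        ih (hnbr _ fun l => by simpa using abs_intVec_le (d + 1) i l)⟩).trans ?_
    rw [stepAvg_comp_transverse hI y hm, ← hitProb_succ (Set.mem_univ _) h0]
    have hle := hitProb_le_succ (E := intVec (d + 1 - m)) (D := Set.univ) (F := {0}) k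
      (transverse hI y x)
    nlinarith [mul_le_mul_of_nonneg_left hle (show 0 ≤ (m : ℝ) / (d + 1) by positivity)]

end Transverse

/-- A bound for the chance to return to a lattice section of dimension `m` of the infinite lattice,
so that `chi d m lam = exp lam * sectionReturn d m`. -/
noncomputable def sectionReturn (d m : ℕ) : ℝ :=
  (m : ℝ) / (d + 1) + (1 - (m : ℝ) / (d + 1)) * returnProb (d + 1 - m)

section LatticeSection

variable {d m N : ℕ} {F : Set (Cylinder d N)} {z : Cylinder d N}

lemma stepAvg_hitProb_univ_le {M : ℕ} (hm : m ≤ d) (hN : M < N)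
    (hF : F ∈ latticeSections d N m) (hz : z ∈ F) :
    stepAvg (cylVec d N) (hitProb (cylVec d N) Set.univ F M) z ≤ sectionReturn d m := by
  obtain ⟨I, y, hIm, rfl⟩ := hF
  obtain ⟨x, hx, rfl⟩ := hz
  have hI : Iᶜ.card = d + 1 - m := by rw [Finset.card_compl, Fintype.card_fin, hIm]
  have : NeZero (d + 1 - m) := ⟨by omega⟩
  have h0 : transverse hI y x = 0 := by
    funext a
    exact sub_eq_zero.2 (hx _ (orderEmbOfFin_compl_notMem hI a))
  have hnbr : ∀ s : Fin (d + 1) → ℤ, (∀ i, |s i - x i| ≤ 1) → ∀ i ∉ I, |s i - y i| + M ≤ N := by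
    intro s hs i hi
    have := hs i
    rw [hx i hi] at this
    omega
  have hle : (m : ℝ) / (d + 1) ≤ 1 := by
    rw [div_le_one (by positivity)]
    exact_mod_cast hm.trans d.le_succ
  rw [stepAvg_cylVec_proj]
  refine (stepAvg_le_stepAvg (g := hitProb (intVec (d + 1 - m)) Set.univ {0} M ∘ transverse hI y)
    fun i => ⟨hitProb_proj_le hI y hm M (hnbr _ fun l => by simpa using abs_intVec_le (d + 1) i l),
      hitProb_proj_le hI y hm M
        (hnbr _ fun l => by simpa using abs_intVec_le (d + 1) i l)⟩).trans ?_
  rw [stepAvg_comp_transverse hI y hm, h0]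
  exact add_le_add (mul_le_of_le_one_right (by positivity) (hitProb_le_one _ _))
    (mul_le_mul_of_nonneg_left (stepAvg_hitProb_le_returnProb M) (sub_nonneg.2 hle))

/-- The constant in the heat kernel bound for three transverse coordinates. -/
noncomputable def heatConst (d : ℕ) : ℝ := 4 * Real.exp ((d + 1) / 4) * (2 * (d + 1)) ^ 3

lemma heatConst_pos (d : ℕ) : 0 < heatConst d := by
  unfold heatConst
  positivity

lemma stepAvg_pow_indicator_latticeSection_le [NeZero N] (hd : 3 ≤ d) (hm : m ≤ d - 2)
    (hF : F ∈ latticeSections d N m) {n : ℕ} (hn : 0 < n) (z : Cylinder d N) :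
    (stepAvg (cylVec d N) ^ n) (F.indicator fun _ => (1 : ℝ)) z ≤
      heatConst d * (1 / (N : ℝ) ^ 3 + 1 / √n ^ 3) := by
  obtain ⟨I, y, hIm, rfl⟩ := hF
  obtain ⟨J, hJI, hJ⟩ : ∃ J ⊆ Iᶜ, J.card = 3 := Finset.exists_subset_card_eq (by
    rw [Finset.card_compl, Fintype.card_fin, hIm]
    omega)
  have hle := stepAvg_pow_indicator_le (J := J) (y := fun i => (y i : ZMod N))
    (F := proj d N '' {x | ∀ i, i ∉ I → x i = y i}) (by omega) (fun w hw i hi => by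
      obtain ⟨x, hx, rfl⟩ := hw
      rw [residue_proj, hx i (Finset.mem_compl.1 (hJI hi))]) hn z
  rw [hJ] at hle
  refine hle.trans ?_
  rw [heatConst, mul_comm (4 : ℝ), mul_assoc, mul_assoc]
  gcongr
  calc (1 / (N : ℝ) + 2 * (d + 1) / √n) ^ 3
      ≤ (2 * (d + 1) * (1 / N) + 2 * (d + 1) / √n) ^ 3 := by
        gcongr
        exact le_mul_of_one_le_left (by positivity) (by linarith [d.cast_nonneg (α := ℝ)])
    _ = (2 * (d + 1)) ^ 3 * (1 / N + 1 / √n) ^ 3 := by ring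
    _ ≤ (2 * (d + 1)) ^ 3 * (2 ^ 2 * ((1 / (N : ℝ)) ^ 3 + (1 / √n) ^ 3)) := by
        gcongr
        exact add_pow_le (by positivity) (by positivity) 3
    _ = _ := by ring

lemma summable_one_div_sqrt_pow_three : Summable fun n : ℕ => 1 / √(n : ℝ) ^ 3 := by
  refine (Real.summable_one_div_nat_rpow (p := 3 / 2).2 (by norm_num)).congr fun n => ?_
  rw [Real.sqrt_eq_rpow, ← Real.rpow_natCast, ← Real.rpow_mul n.cast_nonneg]
  norm_num

lemma sum_stepAvg_pow_indicator_le [NeZero N] (hd : 3 ≤ d) (hm : m ≤ d - 2)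
    (hF : F ∈ latticeSections d N m) (L : ℕ) {M : ℕ} (hM : 0 < M) (z : Cylinder d N) :
    ∑ k ∈ Finset.range L, (stepAvg (cylVec d N) ^ (M + k)) (F.indicator fun _ => (1 : ℝ)) z ≤
      heatConst d * (L / (N : ℝ) ^ 3 + ∑' k : ℕ, 1 / √((k + M : ℕ) : ℝ) ^ 3) := by
  have htail : ∑ k ∈ Finset.range L, 1 / √((k + M : ℕ) : ℝ) ^ 3 ≤
      ∑' k : ℕ, 1 / √((k + M : ℕ) : ℝ) ^ 3 :=
    ((summable_nat_add_iff (f := fun n : ℕ => 1 / √(n : ℝ) ^ 3) M).2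
      summable_one_div_sqrt_pow_three).sum_le_tsum _ fun k _ => by positivity
  have hC := heatConst_pos d
  calc ∑ k ∈ Finset.range L, (stepAvg (cylVec d N) ^ (M + k)) (F.indicator fun _ => (1 : ℝ)) z
      ≤ ∑ k ∈ Finset.range L, heatConst d * (1 / (N : ℝ) ^ 3 + 1 / √((k + M : ℕ) : ℝ) ^ 3) := by
        refine Finset.sum_le_sum fun k _ => ?_
        rw [add_comm k M]
        exact stepAvg_pow_indicator_latticeSection_le hd hm hF (by omega) z
    _ = heatConst d * (L / (N : ℝ) ^ 3 + ∑ k ∈ Finset.range L, 1 / √((k + M : ℕ) : ℝ) ^ 3) := by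
        rw [← Finset.mul_sum, Finset.sum_add_distrib, Finset.sum_const, Finset.card_range,
          nsmul_eq_mul, mul_one_div]
    _ ≤ _ := by gcongr

/-- A return within `M` steps is a return in the infinite lattice; later visits are summed up to a
time `L` by which the walk has left the block. -/
lemma stepAvg_hitProb_outerBlock_le (hd : 3 ≤ d) (hm : m ≤ d - 2) (hF : F ∈ latticeSections d N m)
    (hz : z ∈ F) {M L : ℕ} (hM : M < N) (hL : 0 < L) (j : ℤ) (n : ℕ) :
    stepAvg (cylVec d N) (hitProb (cylVec d N) (outerBlock d N j) F n) z ≤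
      sectionReturn d m +
        (heatConst d * (L / (N : ℝ) ^ 3 + ∑' k : ℕ, 1 / √((k + (M + 1) : ℕ) : ℝ) ^ 3) +
          4 * (d + 1) * (N : ℝ) ^ 2 / L) := by
  have : NeZero N := ⟨by omega⟩
  set E := cylVec d N
  set D := outerBlock d N j
  set φ : Cylinder d N → ℝ :=
    ∑ k ∈ Finset.range L, (stepAvg E ^ k) (F.indicator fun _ => (1 : ℝ)) + survProb E D L with hφ
  have hφ0 : 0 ≤ φ := add_nonneg
    (Finset.sum_nonneg fun k _ => stepAvg_pow_nonneg indicator_one_nonneg k) (survProb_nonneg L)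
  have hsplit : hitProb E D F n ≤ hitProb E Set.univ F M + (stepAvg E ^ M) φ := fun x =>
    hitProb_le_hitProb_univ_add hφ0 (fun n x => by
      simpa [hφ] using hitProb_le_sum_add_survProb L n x) M n x
  have hmono := stepAvg_mono (E := E) hsplit z
  have hpow : stepAvg E ((stepAvg E ^ M) φ) z =
      ∑ k ∈ Finset.range L, (stepAvg E ^ (M + 1 + k)) (F.indicator fun _ => (1 : ℝ)) z +
        (stepAvg E ^ (M + 1)) (survProb E D L) z := by
    rw [← Module.End.mul_apply, ← pow_succ', hφ, map_add, map_sum]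
    simp only [Pi.add_apply, Finset.sum_apply, pow_add, Module.End.mul_apply]
  rw [map_add, Pi.add_apply, hpow] at hmono
  refine hmono.trans (add_le_add (stepAvg_hitProb_univ_le (by omega) hM hF hz) (add_le_add ?_ ?_))
  · exact sum_stepAvg_pow_indicator_le hd hm hF L M.succ_pos z
  · exact stepAvg_pow_survProb_outerBlock_le j (M + 1) hL z

end LatticeSection

lemma eventually_stepAvg_hitProb_le {d m : ℕ} (hd : 3 ≤ d) (hm : m ≤ d - 2) {ε : ℝ} (hε : 0 < ε) :
    ∀ᶠ N : ℕ in atTop, ∀ (j : ℤ), ∀ F ∈ latticeSections d N m, ∀ z ∈ F, ∀ n : ℕ,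
      stepAvg (cylVec d N) (hitProb (cylVec d N) (outerBlock d N j) F n) z ≤
        sectionReturn d m + ε := by
  have htail : Tendsto (fun M : ℕ => heatConst d * ∑' k : ℕ, 1 / √((k + (M + 1) : ℕ) : ℝ) ^ 3)
      atTop (nhds 0) := by
    rw [← mul_zero (heatConst d)]
    exact ((tendsto_sum_nat_add fun n : ℕ => 1 / √(n : ℝ) ^ 3).comp
      (tendsto_add_atTop_nat 1)).const_mul _
  have hε3 : 0 < ε / 3 := by positivity
  obtain ⟨M, hM⟩ := (htail.eventually_lt_const hε3).exists
  obtain ⟨K, hK, hK0⟩ := (((tendsto_const_div_atTop_nhds_zero_nat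
    (4 * (d + 1) : ℝ)).eventually_lt_const hε3).and (eventually_gt_atTop 0)).exists
  filter_upwards [(tendsto_const_div_atTop_nhds_zero_nat (heatConst d * K)).eventually_lt_const hε3,
    eventually_gt_atTop M] with N hN hMN j F hF z hz n
  have hN0 : 0 < N := by omega
  have : (0 : ℝ) < K := Nat.cast_pos.2 hK0
  have : (0 : ℝ) < N := Nat.cast_pos.2 hN0
  have hle := stepAvg_hitProb_outerBlock_le hd hm hF hz hMN (L := K * N ^ 2) (by positivity) j n
  push_cast at hle hM
  have hfirst : heatConst d * (K * (N : ℝ) ^ 2 / N ^ 3) = heatConst d * K / N := by field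
  have hlast : 4 * (d + 1) * (N : ℝ) ^ 2 / (K * N ^ 2) = 4 * (d + 1) / K := by field
  rw [mul_add, hfirst, hlast] at hle
  linarith

/-! ### Hitting probabilities from afar -/

lemma innerBlock_subset_outerBlock {d N : ℕ} {j : ℤ} (hN : 1 ≤ N) :
    innerBlock d N j ⊆ outerBlock d N j := by
  rintro z ⟨hlo, hhi⟩
  have : (1 : ℤ) ≤ N := by exact_mod_cast hN
  constructor <;> linarith

lemma abs_snd_sub_le_of_mem_block {d N : ℕ} {j : ℤ} {z : Cylinder d N} (hz : z ∈ block d N j) :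
    |(z.2 : ℝ) - j * N| ≤ 3 / 4 * N := by
  obtain ⟨hlo, hhi⟩ := hz
  rw [abs_le]
  constructor <;> linarith

lemma block_subset_innerBlock {d N : ℕ} {j : ℤ} : block d N j ⊆ innerBlock d N j := by
  intro z hz
  obtain ⟨hlo, hhi⟩ := abs_le.1 (abs_snd_sub_le_of_mem_block hz)
  have : (0 : ℝ) ≤ N := N.cast_nonneg
  constructor
  · have : ((j : ℝ) - 1) * N ≤ z.2 := by linarith
    exact_mod_cast this
  · have : (z.2 : ℝ) ≤ ((j : ℝ) + 1) * N := by linarith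
    exact_mod_cast this

lemma stepAvg_comp_sub_right {G ι : Type*} [AddCommGroup G] [Fintype ι] {E : ι → G} (f : G → ℝ)
    (x z : G) : stepAvg E (fun w => f (w - x)) z = stepAvg E f (z - x) := by
  simp only [stepAvg_apply, add_sub_right_comm, sub_right_comm]

section HitSet

variable {d N : ℕ} [NeZero N] {j : ℤ} {A : Finset (Cylinder d N)} {z : Cylinder d N}

lemma greenFun_sub_nonneg (hd : 0 < d) {x : Cylinder d N} (hx : x ∈ block d N j)
    (hz : |z.2 - j * N| ≤ 2 * N) : 0 ≤ greenFun (greenHeight d N) (z - x) := by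
  refine greenFun_nonneg hd ?_
  have hx' := abs_snd_sub_le_of_mem_block hx
  have hz' : |(z.2 : ℝ) - j * N| ≤ 2 * N := by exact_mod_cast hz
  have hle : |((z - x).2 : ℝ)| ≤ 3 * N := by
    rw [Prod.snd_sub, Int.cast_sub]
    refine (abs_sub_le _ (j * N : ℝ) _).trans ?_
    rw [abs_sub_comm (j * N : ℝ)]
    linarith [N.cast_nonneg (α := ℝ)]
  exact_mod_cast hle

lemma hitProb_le_sum_greenFun (hd : 0 < d) (hA : (A : Set (Cylinder d N)) ⊆ block d N j) (n : ℕ)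
    (hz : |z.2 - j * N| ≤ 2 * N) :
    hitProb (cylVec d N) (outerBlock d N j) A n z ≤
      ∑ x ∈ A, greenFun (greenHeight d N) (z - x) := by
  have hnonneg : ∀ w : Cylinder d N, |w.2 - j * N| ≤ 2 * N → ∀ x ∈ A,
      0 ≤ greenFun (greenHeight d N) (w - x) :=
    fun w hw x hx => greenFun_sub_nonneg hd (hA hx) hw
  refine hitProb_le_of_superharmonic (U := {w : Cylinder d N | |w.2 - j * N| ≤ 2 * N})
    (φ := fun w => ∑ x ∈ A, greenFun (greenHeight d N) (w - x))
    (fun w hw i => abs_snd_add_cylVec_sub_le hw i)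
    (fun w hw => Finset.sum_nonneg (hnonneg w hw)) (fun w hw hwA => ?_) (fun w _ => ?_) n hz
  · refine le_trans ?_ (Finset.single_le_sum (f := fun x => greenFun (greenHeight d N) (w - x))
      (hnonneg w (by linarith [abs_snd_sub_le_of_mem_outerBlock hw])) hwA)
    simpa only [sub_self] using one_le_greenFun_zero hd
  · rw [← Finset.sum_fn, map_sum, Finset.sum_apply]
    refine Finset.sum_le_sum fun x _ => ?_
    rw [stepAvg_comp_sub_right, stepAvg_greenFun]
    split_ifs <;> linarith

lemma hitProb_le_of_abs_snd_sub_eq (hd : 0 < d) (hA : (A : Set (Cylinder d N)) ⊆ block d N j)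
    (n : ℕ) (hz : |z.2 - j * N| = N) :
    hitProb (cylVec d N) (outerBlock d N j) A n z ≤
      A.card * ((d + 1) * (2 * freqConst d + 3) * (N / (N : ℝ) ^ d)) := by
  refine (hitProb_le_sum_greenFun hd hA n (by omega)).trans ?_
  rw [← nsmul_eq_mul]
  refine Finset.sum_le_card_nsmul _ _ _ fun x hx => greenFun_le_of_le hd ?_
  have hx' := abs_snd_sub_le_of_mem_block (hA hx)
  have hz' : |(z.2 : ℝ) - j * N| = N := by exact_mod_cast hz
  have htri := abs_sub_le (z.2 : ℝ) x.2 (j * N)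
  rw [Prod.snd_sub, Int.cast_sub]
  linarith

/-- The points of `B_0`. -/
noncomputable def initialBlock (d N : ℕ) [NeZero N] : Finset (Cylinder d N) :=
  Finset.univ ×ˢ Finset.Icc (-(N : ℤ)) N

lemma coe_initialBlock : (initialBlock d N : Set (Cylinder d N)) = innerBlock d N 0 := by
  ext z
  simp [initialBlock, innerBlock]

lemma card_Icc_neg_self (N : ℕ) : (Finset.Icc (-(N : ℤ)) N).card = 2 * N + 1 := by
  rw [Int.card_Icc]
  omega

lemma card_initialBlock : (initialBlock d N).card = (2 * N + 1) * N ^ d := by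
  rw [initialBlock, Finset.card_product, card_Icc_neg_self, Finset.card_univ, Fintype.card_fun,
    ZMod.card, Fintype.card_fin, mul_comm]

lemma initialBlock_nonempty : (initialBlock d N).Nonempty := by
  rw [← Finset.card_pos, card_initialBlock]
  exact mul_pos (Nat.succ_pos _) (pow_pos (Nat.pos_of_neZero N) d)

lemma sum_greenFun_sub_le (x : Cylinder d N) (s : ℤ) :
    ∑ h, greenFun (greenHeight d N) ((h, s) - x) ≤ (d + 1) * greenHeight d N := by
  calc ∑ h, greenFun (greenHeight d N) ((h, s) - x)
      = ∑ h, greenFun (greenHeight d N) ((h, s - x.2) : Cylinder d N) :=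
        Equiv.sum_comp (Equiv.subRight x.1)
          fun h => greenFun (greenHeight d N) ((h, s - x.2) : Cylinder d N)
    _ = (d + 1) * (greenHeight d N - |((s - x.2 : ℤ) : ℝ)|) := sum_greenFun _ _
    _ ≤ _ := by
        gcongr
        exact sub_le_self _ (abs_nonneg _)

lemma sum_hitProb_at_height_le (hd : 0 < d) (hA : (A : Set (Cylinder d N)) ⊆ block d N j) (n : ℕ)
    (s : ℤ) :
    ∑ h, (innerBlock d N j).indicator (hitProb (cylVec d N) (outerBlock d N j) A n) (h, s) ≤
      A.card * ((d + 1) * greenHeight d N) := by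
  by_cases hs : |s - j * N| ≤ N
  · calc ∑ h, (innerBlock d N j).indicator (hitProb (cylVec d N) (outerBlock d N j) A n) (h, s)
        ≤ ∑ h, ∑ x ∈ A, greenFun (greenHeight d N) ((h, s) - x) :=
          Finset.sum_le_sum fun h _ =>
            (Set.indicator_le_self' (fun z _ => hitProb_nonneg n z) _).trans
              (hitProb_le_sum_greenFun hd hA n (by dsimp only; omega))
      _ = ∑ x ∈ A, ∑ h, greenFun (greenHeight d N) ((h, s) - x) := Finset.sum_comm
      _ ≤ ∑ _x ∈ A, (d + 1) * greenHeight d N :=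
          Finset.sum_le_sum fun x _ => sum_greenFun_sub_le x s
      _ = _ := by rw [Finset.sum_const, nsmul_eq_mul]
  · have hmem : ∀ h, ((h, s) : Cylinder d N) ∉ innerBlock d N j := by
      rintro h ⟨hlo, hhi⟩
      refine hs (abs_le.2 ⟨?_, ?_⟩) <;> dsimp only at hlo hhi <;> linarith
    have := freqConst_pos d
    simp only [Set.indicator_of_notMem (hmem _), Finset.sum_const_zero, greenHeight]
    positivity

lemma sum_hitProb_le (hd : 0 < d) (hA : (A : Set (Cylinder d N)) ⊆ block d N j) (n : ℕ) :
    ∑ z ∈ initialBlock d N,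
        (innerBlock d N j).indicator (hitProb (cylVec d N) (outerBlock d N j) A n) z ≤
      (initialBlock d N).card * (A.card * ((d + 1) * (freqConst d + 3) * (N / (N : ℝ) ^ d))) := by
  have hN : (N : ℝ) ≠ 0 := Nat.cast_ne_zero.2 (NeZero.ne N)
  rw [card_initialBlock, initialBlock, Finset.sum_product_right]
  refine (Finset.sum_le_sum fun s _ => sum_hitProb_at_height_le hd hA n s).trans_eq ?_
  rw [Finset.sum_const, card_Icc_neg_self, nsmul_eq_mul, greenHeight]
  push_cast
  field

end HitSet

/-! ### Entrance times along a path -/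

section Entrance

variable {G : Type*} {U : Set G} {t : ℕ∞} {ω : ℕ → G}

lemma entranceFrom_le {n : ℕ} (ht : t ≤ n) (hn : ω n ∈ U) : entranceFrom U t ω ≤ n :=
  iInf₂_le n ⟨ht, hn⟩

lemma le_entranceFrom {a : ℕ∞} (h : ∀ n : ℕ, t ≤ n → ω n ∈ U → a ≤ n) :
    a ≤ entranceFrom U t ω :=
  le_iInf₂ fun n hn => h n hn.1 hn.2

lemma entranceFrom_eq_coe {n : ℕ} (h : entranceFrom U t ω = n) : t ≤ n ∧ ω n ∈ U := by
  have hlt : entranceFrom U t ω < (n + 1 : ℕ) := by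
    rw [h]
    exact_mod_cast n.lt_succ_self
  simp only [entranceFrom, iInf_lt_iff] at hlt
  obtain ⟨k, hk, hkn⟩ := hlt
  have hnk : (n : ℕ∞) ≤ k := h ▸ entranceFrom_le hk.1 hk.2
  obtain rfl : k = n :=
    le_antisymm (Nat.lt_succ_iff.1 (by exact_mod_cast hkn)) (by exact_mod_cast hnk)
  exact hk

lemma entranceFrom_prepend (z : G) :
    entranceFrom U (t + 1) (prepend z ω) = entranceFrom U t ω + 1 := by
  refine le_antisymm ?_ (le_entranceFrom fun n hn hU => ?_)
  · cases h : entranceFrom U t ω with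
    | top => simp
    | coe n =>
      obtain ⟨ht, hn⟩ := entranceFrom_eq_coe h
      exact_mod_cast entranceFrom_le (n := n + 1) (by exact_mod_cast add_le_add_left ht 1) hn
  · cases n with
    | zero => simp at hn
    | succ n =>
      push_cast at hn ⊢
      gcongr
      exact entranceFrom_le (by simpa using hn) hU

lemma entranceFrom_prepend_of_mem {z : G} (hz : z ∈ U) : entranceFrom U 0 (prepend z ω) = 0 :=
  nonpos_iff_eq_zero.1 (entranceFrom_le (n := 0) le_rfl hz)

lemma entranceFrom_prepend_of_notMem {z : G} (hz : z ∉ U) :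
    entranceFrom U 0 (prepend z ω) = entranceFrom U 0 ω + 1 := by
  rw [← entranceFrom_prepend z]
  refine le_antisymm (le_entranceFrom fun n _ hU => entranceFrom_le (by simp) hU)
    (le_entranceFrom fun n _ hU => entranceFrom_le ?_ hU)
  cases n with
  | zero => exact absurd hU hz
  | succ n => simp

lemma entranceFrom_eq_coe_iff {n : ℕ} :
    entranceFrom U t ω = n ↔ (t ≤ n ∧ ω n ∈ U) ∧ ∀ k < n, ¬(t ≤ k ∧ ω k ∈ U) := by
  refine ⟨fun h => ⟨entranceFrom_eq_coe h, fun k hk hk' => ?_⟩, fun ⟨hn, hk⟩ => ?_⟩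
  · have : (n : ℕ∞) ≤ k := h ▸ entranceFrom_le hk'.1 hk'.2
    exact hk.not_ge (by exact_mod_cast this)
  · refine le_antisymm (entranceFrom_le hn.1 hn.2) (le_entranceFrom fun k ht hU => ?_)
    exact_mod_cast not_lt.1 fun hlt => hk k hlt ⟨ht, hU⟩

lemma measurable_entranceFrom [MeasurableSpace G] [DiscreteMeasurableSpace G]
    {τ : (ℕ → G) → ℕ∞} (hτ : Measurable τ) :
    Measurable fun ω : ℕ → G => entranceFrom U (τ ω) ω := by
  have hmeas : ∀ k : ℕ, MeasurableSet {ω : ℕ → G | τ ω ≤ k ∧ ω k ∈ U} := fun k =>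
    (hτ (MeasurableSet.of_discrete (s := Set.Iic (k : ℕ∞)))).inter
      (measurable_pi_apply (X := fun _ => G) k (MeasurableSet.of_discrete (s := U)))
  refine ENat.measurable_iff.2 fun n => ?_
  have hpre : (fun ω : ℕ → G => entranceFrom U (τ ω) ω) ⁻¹' {(n : ℕ∞)} =
      {ω | τ ω ≤ n ∧ ω n ∈ U} ∩ ⋂ k ∈ Finset.range n, {ω : ℕ → G | τ ω ≤ k ∧ ω k ∈ U}ᶜ := by
    ext ω
    simp [entranceFrom_eq_coe_iff]
  rw [hpre]
  exact (hmeas n).inter (Finset.measurableSet_biInter _ fun k _ => (hmeas k).compl)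

end Entrance

/-! ### Excursions -/

section Excursion

variable {G : Type*} (B D : Set G)

/-- The first exit from `D` after the first visit to `B` from time `t` on. -/
noncomputable def nextExit (ω : ℕ → G) (t : ℕ∞) : ℕ∞ := entranceFrom Dᶜ (entranceFrom B t ω) ω

/-- The end of the `k`-th excursion, an excursion running from a visit to `B` to the next exit
from `D`. -/
noncomputable def excursionEnd (k : ℕ) (ω : ℕ → G) : ℕ∞ := (nextExit B D ω)^[k] 0

/-- The end of the `k`-th excursion after the first exit from `D`: the end of the current excursion
and `k` further ones for a walk that is in the midst of an excursion. -/
noncomputable def exitThenExcursionEnd (k : ℕ) (ω : ℕ → G) : ℕ∞ :=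
  (nextExit B D ω)^[k] (entranceFrom Dᶜ 0 ω)

lemma departure_eq_excursionEnd (d N : ℕ) (j : ℤ) (k : ℕ) (ω : ℕ → Cylinder d N) :
    departure d N j k ω = excursionEnd (innerBlock d N j) (outerBlock d N j) k ω := by
  induction k with
  | zero => rfl
  | succ k ih =>
    rw [excursionEnd, Function.iterate_succ_apply', ← excursionEnd, ← ih]
    rfl

variable {B D}

lemma iterate_nextExit_prepend (z : G) (ω : ℕ → G) (k : ℕ) (t : ℕ∞) :
    (nextExit B D (prepend z ω))^[k] (t + 1) = (nextExit B D ω)^[k] t + 1 := by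
  induction k with
  | zero => rfl
  | succ k ih =>
    rw [Function.iterate_succ_apply', Function.iterate_succ_apply', ih, nextExit,
      entranceFrom_prepend, entranceFrom_prepend, nextExit]

lemma exitThenExcursionEnd_prepend_of_mem {z : G} (hz : z ∈ D) (k : ℕ) (ω : ℕ → G) :
    exitThenExcursionEnd B D k (prepend z ω) = exitThenExcursionEnd B D k ω + 1 := by
  rw [exitThenExcursionEnd, entranceFrom_prepend_of_notMem (Set.notMem_compl_iff.2 hz),
    iterate_nextExit_prepend, exitThenExcursionEnd]

lemma exitThenExcursionEnd_prepend_of_notMem {z : G} (hz : z ∉ D) (k : ℕ) (ω : ℕ → G) :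
    exitThenExcursionEnd B D k (prepend z ω) = excursionEnd B D k (prepend z ω) := by
  rw [exitThenExcursionEnd, entranceFrom_prepend_of_mem (Set.mem_compl hz), excursionEnd]

lemma excursionEnd_succ_prepend_of_mem {z : G} (hz : z ∈ B) (k : ℕ) (ω : ℕ → G) :
    excursionEnd B D (k + 1) (prepend z ω) = exitThenExcursionEnd B D k (prepend z ω) := by
  rw [excursionEnd, Function.iterate_succ_apply, nextExit, entranceFrom_prepend_of_mem hz,
    exitThenExcursionEnd]

lemma excursionEnd_succ_prepend_of_notMem {z : G} (hz : z ∉ B) (k : ℕ) (ω : ℕ → G) :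
    excursionEnd B D (k + 1) (prepend z ω) = excursionEnd B D (k + 1) ω + 1 := by
  rw [excursionEnd, Function.iterate_succ_apply, nextExit, entranceFrom_prepend_of_notMem hz,
    entranceFrom_prepend, iterate_nextExit_prepend, excursionEnd, Function.iterate_succ_apply,
    nextExit]

section Measurability

variable [MeasurableSpace G] [DiscreteMeasurableSpace G]

lemma measurable_iterate_nextExit {τ : (ℕ → G) → ℕ∞} (hτ : Measurable τ) (k : ℕ) :
    Measurable fun ω : ℕ → G => (nextExit B D ω)^[k] (τ ω) := by
  induction k with
  | zero => exact hτ
  | succ k ih =>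
    simp only [Function.iterate_succ_apply']
    exact measurable_entranceFrom (measurable_entranceFrom ih)

lemma measurable_excursionEnd (k : ℕ) : Measurable (excursionEnd B D k) :=
  measurable_iterate_nextExit measurable_const k

lemma measurable_exitThenExcursionEnd (k : ℕ) : Measurable (exitThenExcursionEnd B D k) :=
  measurable_iterate_nextExit (measurable_entranceFrom measurable_const) k

end Measurability

open Classical in
/-- The number of visits to `A` before the times `n` and `τ`. -/
noncomputable def visitsBefore (A : Set G) (n : ℕ) (τ : ℕ∞) (ω : ℕ → G) : ℕ :=
  ∑ i ∈ Finset.range n, if ω i ∈ A ∧ (i : ℕ∞) < τ then 1 else 0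

open Classical in
lemma visitsBefore_prepend (A : Set G) (n : ℕ) (τ : ℕ∞) (z : G) (ω : ℕ → G) :
    visitsBefore A (n + 1) (τ + 1) (prepend z ω) =
      (if z ∈ A then 1 else 0) + visitsBefore A n τ ω := by
  rw [visitsBefore, Finset.sum_range_succ', visitsBefore, add_comm]
  simp

lemma visitsBefore_zero (A : Set G) (n : ℕ) (ω : ℕ → G) : visitsBefore A n 0 ω = 0 := by
  simp [visitsBefore]

lemma visitsBefore_mono (A : Set G) (τ : ℕ∞) (ω : ℕ → G) :
    Monotone fun n => visitsBefore A n τ ω := fun _ _ h =>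
  Finset.sum_le_sum_of_subset (Finset.range_mono h)

/-- The exponential weight `e ^ (lam V)` of the number `V` of visits to `A` before the times `n`
and `τ`. -/
noncomputable def visitWeight (lam : ℝ) (A : Set G) (n : ℕ) (τ : ℕ∞) (ω : ℕ → G) : ENNReal :=
  ENNReal.ofReal (Real.exp (lam * visitsBefore A n τ ω))

lemma visitWeight_zero_left (lam : ℝ) (A : Set G) (τ : ℕ∞) (ω : ℕ → G) :
    visitWeight lam A 0 τ ω = 1 := by
  simp [visitWeight, visitsBefore]

lemma visitWeight_zero_right (lam : ℝ) (A : Set G) (n : ℕ) (ω : ℕ → G) :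
    visitWeight lam A n 0 ω = 1 := by
  simp [visitWeight, visitsBefore_zero]

lemma visitWeight_prepend_of_mem {A : Set G} {z : G} (hz : z ∈ A) (lam : ℝ) (n : ℕ) (τ : ℕ∞)
    (ω : ℕ → G) : visitWeight lam A (n + 1) (τ + 1) (prepend z ω) =
      ENNReal.ofReal (Real.exp lam) * visitWeight lam A n τ ω := by
  rw [visitWeight, visitsBefore_prepend, if_pos hz, visitWeight,
    ← ENNReal.ofReal_mul (Real.exp_pos lam).le, ← Real.exp_add, Nat.cast_add, Nat.cast_one,
    mul_one_add]

lemma visitWeight_prepend_of_notMem {A : Set G} {z : G} (hz : z ∉ A) (lam : ℝ) (n : ℕ) (τ : ℕ∞)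
    (ω : ℕ → G) :
    visitWeight lam A (n + 1) (τ + 1) (prepend z ω) = visitWeight lam A n τ ω := by
  rw [visitWeight, visitsBefore_prepend, if_neg hz, zero_add, visitWeight]

section Measurability

variable [MeasurableSpace G] [DiscreteMeasurableSpace G]

lemma measurable_visitWeight (lam : ℝ) (A : Set G)
    (n : ℕ) {τ : (ℕ → G) → ℕ∞} (hτ : Measurable τ) :
    Measurable fun ω : ℕ → G => visitWeight lam A n (τ ω) ω := by
  classical
  have hvisits : Measurable fun ω : ℕ → G => visitsBefore A n (τ ω) ω := by
    refine Finset.measurable_sum _ fun i _ => Measurable.ite ?_ measurable_const measurable_const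
    exact (measurable_pi_apply (X := fun _ => G) i (MeasurableSet.of_discrete (s := A))).inter
      (hτ (MeasurableSet.of_discrete (s := Set.Ioi (i : ℕ∞))))
  have hexp : Measurable fun k : ℕ => ENNReal.ofReal (Real.exp (lam * k)) :=
    measurable_of_countable _
  exact hexp.comp hvisits

lemma measurable_visitWeight_excursionEnd {lam : ℝ} {A : Set G} {n k : ℕ} :
    Measurable fun ω : ℕ → G => visitWeight lam A n (excursionEnd B D k ω) ω :=
  measurable_visitWeight lam A n (measurable_excursionEnd k)

lemma measurable_visitWeight_exitThenExcursionEnd {lam : ℝ} {A : Set G} {n k : ℕ} :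
    Measurable fun ω : ℕ → G => visitWeight lam A n (exitThenExcursionEnd B D k ω) ω :=
  measurable_visitWeight lam A n (measurable_exitThenExcursionEnd k)

end Measurability

end Excursion

/-! ### The exponential moment of the number of visits -/

section Moment

variable {G ι : Type*} [AddCommGroup G] [Fintype ι] {E : ι → G} {S : Set G} {A B D : Set G}
  {lam ρ γ η W : ℝ} {n k : ℕ} {z : G}

/-- A bound for the exponential moment of the visits in the current and the next `k` excursions,
for a walk in the midst of an excursion: each further excursion costs a factor `W`. -/
noncomputable def insideBound (E : ι → G) (A D : Set G) (γ W : ℝ) (n k : ℕ) (z : G) : ℝ :=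
  (1 + γ * hitProb E D A n z) * W ^ k

open Classical in
/-- A bound for the exponential moment of the visits in the next `k` excursions, for a walk that is
between two excursions. -/
noncomputable def outsideBound (E : ι → G) (A B D : Set G) (γ W : ℝ) (n : ℕ) : ℕ → G → ℝ
  | 0, _ => 1
  | k + 1, z => if z ∈ B then insideBound E A D γ W n k z else W ^ (k + 1)

lemma one_le_insideBound (hγ : 0 ≤ γ) (hW : 1 ≤ W) : 1 ≤ insideBound E A D γ W n k z :=
  one_le_mul_of_one_le_of_one_le
    (le_add_of_nonneg_right (mul_nonneg hγ (hitProb_nonneg n z))) (one_le_pow₀ hW)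

lemma one_le_outsideBound (hγ : 0 ≤ γ) (hW : 1 ≤ W) : 1 ≤ outsideBound E A B D γ W n k z := by
  cases k with
  | zero => exact le_rfl
  | succ k =>
    simp only [outsideBound]
    split_ifs
    exacts [one_le_insideBound hγ hW, one_le_pow₀ hW]

lemma outsideBound_eq_insideBound (hBD : B ⊆ D) (hz : z ∉ D) :
    outsideBound E A B D γ W n k z = insideBound E A D γ W n k z := by
  cases k <;> simp [outsideBound, insideBound, hitProb_of_notMem hz, mt (@hBD z) hz]

lemma outsideBound_succ_le (hγ : 0 ≤ γ) (hη : 0 ≤ η) (hz : z ∈ B → hitProb E D A n z ≤ η) :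
    outsideBound E A B D γ (1 + γ * η) n (k + 1) z ≤ (1 + γ * η) ^ (k + 1) := by
  simp only [outsideBound, insideBound]
  split_ifs with hB
  · rw [pow_succ']
    gcongr
    exact hz hB
  · exact le_rfl

variable [Nonempty ι]

lemma stepAvg_insideBound (z : G) : stepAvg E (insideBound E A D γ W n k) z =
    (1 + γ * stepAvg E (hitProb E D A n) z) * W ^ k := by
  have heq : insideBound E A D γ W n k =
      W ^ k • ((fun _ => (1 : ℝ)) + γ • hitProb E D A n) := by
    funext x
    simp only [insideBound, Pi.smul_apply, Pi.add_apply, smul_eq_mul, mul_comm]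
  rw [heq, map_smul, map_add, map_smul, stepAvg_const]
  simp only [Pi.smul_apply, Pi.add_apply, smul_eq_mul, mul_comm]

lemma stepAvg_insideBound_of_notMem (hD : z ∈ D) (hA : z ∉ A) :
    stepAvg E (insideBound E A D γ W n k) z = insideBound E A D γ W (n + 1) k z := by
  rw [stepAvg_insideBound, insideBound, hitProb_succ hD hA]

lemma exp_mul_stepAvg_insideBound_le (hγ : 0 ≤ γ) (hW : 0 ≤ W)
    (hρ : Real.exp lam * (1 + γ * ρ) ≤ 1 + γ) (hD : z ∈ D) (hA : z ∈ A)
    (hret : stepAvg E (hitProb E D A n) z ≤ ρ) :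
    Real.exp lam * stepAvg E (insideBound E A D γ W n k) z ≤ insideBound E A D γ W (n + 1) k z := by
  rw [stepAvg_insideBound, insideBound, hitProb_succ_of_mem hD hA, mul_one, ← mul_assoc]
  gcongr
  refine le_trans ?_ hρ
  gcongr

variable [MeasurableSpace G] [DiscreteMeasurableSpace G] [MeasurableAdd₂ G]

lemma lintegral_visitWeight_succ_le_insideBound (h : IsStepSet S E) (hγ : 0 ≤ γ) (hW : 1 ≤ W)
    (hρ : Real.exp lam * (1 + γ * ρ) ≤ 1 + γ)
    (hret : z ∈ A → stepAvg E (hitProb E D A n) z ≤ ρ) (hz : z ∈ D)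
    (ih : ∀ x, ∫⁻ ω, visitWeight lam A n (exitThenExcursionEnd B D k ω) ω
      ∂walkLaw (Measure.dirac x) S ≤ ENNReal.ofReal (insideBound E A D γ W n k x)) :
    ∫⁻ ω, visitWeight lam A (n + 1) (exitThenExcursionEnd B D k ω) ω
      ∂walkLaw (Measure.dirac z) S ≤ ENNReal.ofReal (insideBound E A D γ W (n + 1) k z) := by
  have hpos : 0 ≤ insideBound E A D γ W n k :=
    fun x => zero_le_one.trans (one_le_insideBound hγ hW)
  by_cases hA : z ∈ A
  · refine (h.lintegral_walkLaw_le z measurable_visitWeight_exitThenExcursionEnd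
      (φ := Real.exp lam • insideBound E A D γ W n k)
      (smul_nonneg (Real.exp_pos lam).le hpos) fun x => ?_).trans (ENNReal.ofReal_le_ofReal ?_)
    · simp only [exitThenExcursionEnd_prepend_of_mem hz, visitWeight_prepend_of_mem hA]
      rw [lintegral_const_mul _ measurable_visitWeight_exitThenExcursionEnd, Pi.smul_apply,
        smul_eq_mul, ENNReal.ofReal_mul (Real.exp_pos lam).le]
      gcongr
      exact ih x
    · rw [map_smul, Pi.smul_apply, smul_eq_mul]
      exact exp_mul_stepAvg_insideBound_le hγ (zero_le_one.trans hW) hρ hz hA (hret hA)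
  · rw [← stepAvg_insideBound_of_notMem hz hA]
    refine h.lintegral_walkLaw_le z measurable_visitWeight_exitThenExcursionEnd hpos fun x => ?_
    simpa only [exitThenExcursionEnd_prepend_of_mem hz, visitWeight_prepend_of_notMem hA] using ih x

lemma lintegral_visitWeight_succ_le_pow (h : IsStepSet S E) (hAB : A ⊆ B) (hγ : 0 ≤ γ) (hη : 0 ≤ η)
    (hz : z ∉ B)
    (hent : ∀ i, (z + E i ∈ B → hitProb E D A n (z + E i) ≤ η) ∧
      (z - E i ∈ B → hitProb E D A n (z - E i) ≤ η))
    (ih : ∀ x, ∫⁻ ω, visitWeight lam A n (excursionEnd B D (k + 1) ω) ω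
      ∂walkLaw (Measure.dirac x) S ≤
        ENNReal.ofReal (outsideBound E A B D γ (1 + γ * η) n (k + 1) x)) :
    ∫⁻ ω, visitWeight lam A (n + 1) (excursionEnd B D (k + 1) ω) ω
      ∂walkLaw (Measure.dirac z) S ≤ ENNReal.ofReal ((1 + γ * η) ^ (k + 1)) := by
  have hW : 1 ≤ 1 + γ * η := le_add_of_nonneg_right (mul_nonneg hγ hη)
  refine (h.lintegral_walkLaw_le z measurable_visitWeight_excursionEnd
    (φ := outsideBound E A B D γ (1 + γ * η) n (k + 1))
    (fun x => zero_le_one.trans (one_le_outsideBound hγ hW)) fun x => ?_).trans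
    (ENNReal.ofReal_le_ofReal ?_)
  · simpa only [excursionEnd_succ_prepend_of_notMem hz,
      visitWeight_prepend_of_notMem (mt (@hAB z) hz)] using ih x
  · exact stepAvg_le_of_forall fun i =>
      ⟨outsideBound_succ_le hγ hη (hent i).1, outsideBound_succ_le hγ hη (hent i).2⟩

/-- The two bounds feed each other in an induction on the time horizon `n`. -/
lemma lintegral_visitWeight_le (h : IsStepSet S E) (hAB : A ⊆ B) (hBD : B ⊆ D) (hγ : 0 ≤ γ)
    (hη : 0 ≤ η) (hρ : Real.exp lam * (1 + γ * ρ) ≤ 1 + γ)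
    (hret : ∀ z ∈ A, ∀ n, stepAvg E (hitProb E D A n) z ≤ ρ)
    (hent : ∀ z ∉ B, ∀ i n, (z + E i ∈ B → hitProb E D A n (z + E i) ≤ η) ∧
      (z - E i ∈ B → hitProb E D A n (z - E i) ≤ η)) (n : ℕ) :
    (∀ k z, ∫⁻ ω, visitWeight lam A n (exitThenExcursionEnd B D k ω) ω
        ∂walkLaw (Measure.dirac z) S ≤ ENNReal.ofReal (insideBound E A D γ (1 + γ * η) n k z)) ∧
    ∀ k z, ∫⁻ ω, visitWeight lam A n (excursionEnd B D k ω) ω ∂walkLaw (Measure.dirac z) S ≤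
      ENNReal.ofReal (outsideBound E A B D γ (1 + γ * η) n k z) := by
  have := h.isProbabilityMeasure
  have hW : 1 ≤ 1 + γ * η := le_add_of_nonneg_right (mul_nonneg hγ hη)
  induction n with
  | zero =>
    simp only [visitWeight_zero_left, lintegral_one, measure_univ, ENNReal.one_le_ofReal]
    exact ⟨fun _ _ => one_le_insideBound hγ hW, fun _ _ => one_le_outsideBound hγ hW⟩
  | succ n ih =>
    have hin : ∀ k, ∀ z ∈ D, ∫⁻ ω, visitWeight lam A (n + 1) (exitThenExcursionEnd B D k ω) ω
        ∂walkLaw (Measure.dirac z) S ≤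
          ENNReal.ofReal (insideBound E A D γ (1 + γ * η) (n + 1) k z) := fun k z hz =>
      lintegral_visitWeight_succ_le_insideBound h hγ hW hρ (fun hA => hret z hA n) hz (ih.1 k)
    have hout : ∀ k z, ∫⁻ ω, visitWeight lam A (n + 1) (excursionEnd B D k ω) ω
        ∂walkLaw (Measure.dirac z) S ≤
          ENNReal.ofReal (outsideBound E A B D γ (1 + γ * η) (n + 1) k z) := by
      rintro (_ | k) z
      · simp [excursionEnd, visitWeight_zero_right, outsideBound]
      by_cases hz : z ∈ B
      · rw [lintegral_walkLaw_dirac_congr z measurable_visitWeight_excursionEnd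
          measurable_visitWeight_exitThenExcursionEnd
          fun ω => by rw [excursionEnd_succ_prepend_of_mem hz], outsideBound, if_pos hz]
        exact hin k z (hBD hz)
      · rw [outsideBound, if_neg hz]
        exact lintegral_visitWeight_succ_le_pow h hAB hγ hη hz (hent z hz · n) (ih.2 (k + 1))
    refine ⟨fun k z => ?_, hout⟩
    by_cases hz : z ∈ D
    · exact hin k z hz
    · rw [lintegral_walkLaw_dirac_congr z measurable_visitWeight_exitThenExcursionEnd
        measurable_visitWeight_excursionEnd
        fun ω => by rw [exitThenExcursionEnd_prepend_of_notMem hz]]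
      exact (hout k z).trans_eq (by rw [outsideBound_eq_insideBound hBD hz])

end Moment

/-! ### Recurrence -/

section Recurrence

variable {G ι : Type*} [AddCommGroup G] [Fintype ι] [Nonempty ι] {E : ι → G} {S D : Set G}
  [MeasurableSpace G] [DiscreteMeasurableSpace G] [MeasurableAdd₂ G]

lemma IsStepSet.walkLaw_le_of_preimage_prepend (h : IsStepSet S E) (z : G) {Q : Set (ℕ → G)}
    (hQ : MeasurableSet Q) {φ : G → ℝ} (hφ : 0 ≤ φ)
    (hle : ∀ x, walkLaw (Measure.dirac x) S (prepend z ⁻¹' Q) ≤ ENNReal.ofReal (φ x)) :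
    walkLaw (Measure.dirac z) S Q ≤ ENNReal.ofReal (stepAvg E φ z) := by
  rw [← lintegral_indicator_one hQ]
  refine h.lintegral_walkLaw_le z (measurable_one.indicator hQ) hφ fun x => ?_
  exact (lintegral_indicator_one
    (hQ.preimage (measurable_prepend.comp measurable_prodMk_left))).trans_le (hle x)

omit [AddCommGroup G] [MeasurableAdd₂ G] in
lemma measurableSet_forall_mem (p : ℕ → Prop) : MeasurableSet {ω : ℕ → G | ∀ i, p i → ω i ∈ D} := by
  simp only [Set.ofPred_forall]
  exact MeasurableSet.iInter fun i => MeasurableSet.iInter fun _ =>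
    measurable_pi_apply (X := fun _ => G) i (MeasurableSet.of_discrete (s := D))

lemma IsStepSet.walkLaw_forall_lt_mem_le (h : IsStepSet S E) (n : ℕ) (z : G) :
    walkLaw (Measure.dirac z) S {ω | ∀ i, i < n → ω i ∈ D} ≤
      ENNReal.ofReal (survProb E D n z) := by
  have := h.isProbabilityMeasure
  induction n generalizing z with
  | zero => simp [survProb]
  | succ n ih =>
    by_cases hz : z ∈ D
    · rw [survProb_succ hz]
      exact h.walkLaw_le_of_preimage_prepend z (measurableSet_forall_mem _) (survProb_nonneg n)
        fun x => (ih x).trans' (measure_mono fun ω hω i hi => hω (i + 1) (Nat.succ_lt_succ hi))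
    · have hempty : prepend z ⁻¹' {ω | ∀ i, i < n + 1 → ω i ∈ D} = ∅ :=
        Set.eq_empty_of_forall_notMem fun ω hω => hz (hω 0 n.succ_pos)
      rw [survProb_succ_of_notMem hz, ← congrFun (stepAvg_const (E := E) 0) z]
      exact h.walkLaw_le_of_preimage_prepend z (measurableSet_forall_mem _) (fun _ => le_rfl)
        fun x => by rw [hempty, measure_empty]; exact zero_le

lemma IsStepSet.walkLaw_forall_ge_mem_eq_zero (h : IsStepSet S E)
    (hs : ∀ z, Tendsto (fun n => survProb E D n z) atTop (nhds 0)) (n : ℕ) (z : G) :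
    walkLaw (Measure.dirac z) S {ω | ∀ i, n ≤ i → ω i ∈ D} = 0 := by
  induction n generalizing z with
  | zero =>
    have hlim : Tendsto (fun n => ENNReal.ofReal (survProb E D n z)) atTop (nhds 0) := by
      simpa using ENNReal.tendsto_ofReal (hs z)
    refine nonpos_iff_eq_zero.1 (ge_of_tendsto' hlim fun n => ?_)
    exact (h.walkLaw_forall_lt_mem_le n z).trans' (measure_mono fun ω hω i _ => hω i i.zero_le)
  | succ n ih =>
    have hle := h.walkLaw_le_of_preimage_prepend z (measurableSet_forall_mem (D := D) (n + 1 ≤ ·))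
      (φ := fun _ => 0) (fun _ => le_rfl) fun x =>
        ((ih x).trans_le zero_le).trans'
          (measure_mono fun ω hω i hi => hω (i + 1) (Nat.succ_le_succ hi))
    rw [stepAvg_const, ENNReal.ofReal_zero] at hle
    exact nonpos_iff_eq_zero.1 hle

lemma IsStepSet.ae_frequently_notMem (h : IsStepSet S E)
    (hs : ∀ z, Tendsto (fun n => survProb E D n z) atTop (nhds 0)) (z : G) :
    ∀ᵐ ω ∂walkLaw (Measure.dirac z) S, ∃ᶠ i in atTop, ω i ∉ D := by
  simp only [frequently_atTop]
  refine ae_all_iff.2 fun n => ?_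
  simpa [ae_iff] using h.walkLaw_forall_ge_mem_eq_zero hs n z

end Recurrence

lemma excursionEnd_lt_top {G : Type*} {B D : Set G} {ω : ℕ → G} (hB : ∃ᶠ i in atTop, ω i ∈ B)
    (hD : ∃ᶠ i in atTop, ω i ∉ D) (k : ℕ) : excursionEnd B D k ω < ⊤ := by
  have hentrance : ∀ (U : Set G) (t : ℕ∞), (∃ᶠ i in atTop, ω i ∈ U) → t < ⊤ →
      entranceFrom U t ω < ⊤ := by
    intro U t hU ht
    lift t to ℕ using ht.ne
    obtain ⟨i, hi, hiU⟩ := frequently_atTop.1 hU t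
    exact entranceFrom_lt_top_iff.2 ⟨i, by exact_mod_cast hi, hiU⟩
  induction k with
  | zero => exact ENat.natCast_lt_top 0
  | succ k ih =>
    rw [excursionEnd, Function.iterate_succ_apply']
    exact hentrance _ _ hD (hentrance _ _ hB ih)

section CylinderRecurrence

variable {d N : ℕ}

lemma tendsto_survProb_outerBlock (j : ℤ) (z : Cylinder d N) :
    Tendsto (fun n => survProb (cylVec d N) (outerBlock d N j) n z) atTop (nhds 0) := by
  refine tendsto_of_tendsto_of_tendsto_of_le_of_le' tendsto_const_nhds
    (tendsto_const_div_atTop_nhds_zero_nat (4 * (d + 1) * (N : ℝ) ^ 2))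
    (Eventually.of_forall fun n => survProb_nonneg n z) ?_
  filter_upwards [eventually_gt_atTop 0] with n hn
  rw [le_div_iff₀' (Nat.cast_pos.2 hn)]
  exact mul_survProb_outerBlock_le j n z

lemma stepAvg_abs_snd_sub {a : ℤ} {z : Cylinder d N} (hz : z.2 ≠ a) :
    stepAvg (cylVec d N) (fun w => |(w.2 : ℝ) - a|) z = |(z.2 : ℝ) - a| := by
  have habs : |z.2 + 1 - a| + |z.2 - 1 - a| = 2 * |z.2 - a| := by
    rcases hz.lt_or_gt with h | h
    · rw [abs_of_nonpos (by omega), abs_of_nonpos (by omega), abs_of_nonpos (by omega)]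
      ring
    · rw [abs_of_nonneg (by omega), abs_of_nonneg (by omega), abs_of_nonneg (by omega)]
      ring
  have habs' : |(z.2 : ℝ) + 1 - a| + |(z.2 : ℝ) - 1 - a| = 2 * |(z.2 : ℝ) - a| := by
    exact_mod_cast habs
  simp only [stepAvg_cylVec, Finset.sum_const, Finset.card_univ, Fintype.card_fin, nsmul_eq_mul,
    Int.cast_add, Int.cast_sub, Int.cast_one, habs']
  field

lemma mul_survProb_compl_innerBlock_le (j : ℤ) {R : ℕ} (hR : 0 < R) (n : ℕ) {z : Cylinder d N}
    (hz : |z.2 - j * N| ≤ R) :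
    n * survProb (cylVec d N) (innerBlock d N j)ᶜ n z ≤
      (d + 1) * (R : ℝ) ^ 2 + n * (|(z.2 : ℝ) - j * N| / R) := by
  have hR' : (0 : ℝ) < R := Nat.cast_pos.2 hR
  have hle := mul_survProb_le (E := cylVec d N) (D := (innerBlock d N j)ᶜ)
    (K := {w | |w.2 - j * N| < R}) (U := {w | |w.2 - j * N| ≤ R})
    (φ := fun w => (d + 1) * ((R : ℝ) ^ 2 - ((w.2 : ℝ) - j * N) ^ 2))
    (ψ := (R : ℝ)⁻¹ • fun w => |(w.2 : ℝ) - (j * N : ℤ)|)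
    (fun w hw i => ?_) (fun w (hw : |w.2 - j * N| ≤ R) => quadratic_nonneg (by exact_mod_cast hw))
    (fun w => mul_nonneg (by positivity) (abs_nonneg _)) (fun w hw => ?_)
    (fun w _ => (stepAvg_quadratic _ _ w).le) (fun w hw => ?_) n hz
  · have : 0 ≤ (d + 1 : ℝ) * ((z.2 : ℝ) - j * N) ^ 2 := by positivity
    have hψ : ((R : ℝ)⁻¹ • fun w : Cylinder d N => |(w.2 : ℝ) - (j * N : ℤ)|) z =
        |(z.2 : ℝ) - j * N| / R := by
      simp [div_eq_inv_mul]
    rw [hψ] at hle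
    linarith
  · have hw' : |w.2 - j * N| < R := hw.2
    have hstep := abs_snd_add_cylVec_le w i
    have htri := abs_sub_le (w + cylVec d N i).2 w.2 (j * N)
    have htri' := abs_sub_le (w - cylVec d N i).2 w.2 (j * N)
    constructor <;> simp only [Set.mem_ofPred_eq] <;> omega
  · have hw' : (R : ℝ) ≤ |(w.2 : ℝ) - (j * N : ℤ)| := by exact_mod_cast not_lt.1 hw
    simpa [inv_mul_eq_div] using (one_le_div hR').2 hw'
  · have hne : w.2 ≠ j * N := fun h => hw.1 ⟨by rw [h]; nlinarith, by rw [h]; nlinarith⟩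
    rw [map_smul, Pi.smul_apply, stepAvg_abs_snd_sub hne, Pi.smul_apply]

lemma tendsto_survProb_compl_innerBlock (j : ℤ) (z : Cylinder d N) :
    Tendsto (fun n => survProb (cylVec d N) (innerBlock d N j)ᶜ n z) atTop (nhds 0) := by
  refine tendsto_order.2 ⟨fun a ha => Eventually.of_forall fun n =>
    ha.trans_le (survProb_nonneg n z), fun ε hε => ?_⟩
  obtain ⟨R, hR⟩ := exists_nat_gt (max |(z.2 : ℝ) - j * N| (|(z.2 : ℝ) - j * N| / ε))
  obtain ⟨hzR, hεR⟩ := max_lt_iff.1 hR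
  have hR' : (0 : ℝ) < R := (abs_nonneg _).trans_lt hzR
  have hlim : Tendsto (fun n : ℕ => (d + 1) * (R : ℝ) ^ 2 / n + |(z.2 : ℝ) - j * N| / R) atTop
      (nhds (0 + |(z.2 : ℝ) - j * N| / R)) :=
    (tendsto_const_div_atTop_nhds_zero_nat _).add_const _
  rw [zero_add] at hlim
  filter_upwards [hlim.eventually_lt_const ((div_lt_comm₀ hε hR').1 hεR), eventually_gt_atTop 0]
    with n hlt hn
  have hn' : (0 : ℝ) < n := Nat.cast_pos.2 hn
  refine lt_of_le_of_lt ?_ hlt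
  rw [div_add' _ _ _ hn'.ne', le_div_iff₀' hn', mul_comm (_ / _)]
  exact mul_survProb_compl_innerBlock_le j (Nat.cast_pos.1 hR') n (by exact_mod_cast hzR.le)

variable [NeZero N]

lemma lintegral_cylLaw (hN : 3 ≤ N) {f : (ℕ → Cylinder d N) → ENNReal} (hf : Measurable f) :
    ∫⁻ ω, f ω ∂cylLaw d N =
      (∑ z ∈ initialBlock d N, ∫⁻ ω, f ω ∂walkLaw (Measure.dirac z) (steps d N)) /
        (initialBlock d N).card := by
  have := (isStepSet_steps d hN).isProbabilityMeasure
  rw [cylLaw, lintegral_walkLaw _ hf, ← coe_initialBlock, lintegral_uniformOn_finset]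

lemma ae_departure_lt_top (hN : 3 ≤ N) (j : ℤ) (k : ℕ) :
    ∀ᵐ ω ∂cylLaw d N, departure d N j k ω < ⊤ := by
  have hstep := isStepSet_steps d hN
  have hmeas : MeasurableSet {ω : ℕ → Cylinder d N | ¬departure d N j k ω < ⊤} := by
    simp only [departure_eq_excursionEnd]
    exact (measurable_excursionEnd k (MeasurableSet.of_discrete (s := Set.Iio ⊤))).compl
  rw [ae_iff, ← lintegral_indicator_one hmeas, lintegral_cylLaw hN (measurable_one.indicator hmeas),
    ENNReal.div_eq_zero_iff]
  refine Or.inl (Finset.sum_eq_zero fun z _ => ?_)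
  rw [lintegral_indicator_one hmeas, ← ae_iff]
  filter_upwards [hstep.ae_frequently_notMem (tendsto_survProb_compl_innerBlock j) z,
    hstep.ae_frequently_notMem (tendsto_survProb_outerBlock j) z] with ω hB hD
  rw [departure_eq_excursionEnd]
  exact excursionEnd_lt_top (by simpa using hB) hD k

end CylinderRecurrence

/-! ### Visited points -/

section Visited

open Classical in
lemma card_filter_entranceFrom_lt_le {G : Type*} (A : Finset G) (τ : ℕ) (ω : ℕ → G) :
    (A.filter fun x => entranceFrom {x} 0 ω < τ).card ≤ visitsBefore (A : Set G) τ τ ω := by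
  have hcard : visitsBefore (A : Set G) τ τ ω =
      ((Finset.range τ).filter fun i => ω i ∈ (A : Set G) ∧ (i : ℕ∞) < τ).card := by
    rw [visitsBefore, Finset.card_filter]
    exact Finset.sum_congr rfl fun i _ => by congr
  rw [hcard]
  refine (Finset.card_le_card fun x hx => ?_).trans (Finset.card_image_le (f := ω))
  obtain ⟨hxA, hxτ⟩ := Finset.mem_filter.1 hx
  obtain ⟨i, hi⟩ := ENat.ne_top_iff_exists.1 hxτ.ne_top
  have hxi : ω i = x := (entranceFrom_eq_coe hi.symm).2
  rw [← hi] at hxτ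
  exact Finset.mem_image.2 ⟨i, Finset.mem_filter.2
    ⟨Finset.mem_range.2 (by exact_mod_cast hxτ), by rwa [hxi], hxτ⟩, hxi⟩

variable {d N : ℕ} {j : ℤ} {A : Finset (Cylinder d N)} {t lam : ℝ} {ω : ℕ → Cylinder d N}

lemma apply_departure_notMem_outerBlock {k τ : ℕ} (hτ : departure d N j (k + 1) ω = τ) :
    ω τ ∉ outerBlock d N j :=
  (entranceFrom_eq_coe hτ).2

lemma visited_le_visitsBefore (hN : 1 ≤ N) (hA : (A : Set (Cylinder d N)) ⊆ block d N j)
    (ht : 0 < ⌊t⌋₊) {τ : ℕ} (hτ : departure d N j ⌊t⌋₊ ω = τ) :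
    visited d N j A t ω ≤ visitsBefore (A : Set (Cylinder d N)) τ τ ω := by
  classical
  rw [visited, Finset.sum_boole, Nat.cast_le, hτ]
  refine (Finset.card_le_card fun x hx => ?_).trans (card_filter_entranceFrom_lt_le A τ ω)
  obtain ⟨hxA, hxτ⟩ := Finset.mem_filter.1 hx
  refine Finset.mem_filter.2 ⟨hxA, hxτ.lt_of_ne fun heq => ?_⟩
  rw [← Nat.succ_pred_eq_of_pos ht] at hτ
  refine apply_departure_notMem_outerBlock hτ ?_
  rw [show ω τ = x from (entranceFrom_eq_coe heq).2]
  exact innerBlock_subset_outerBlock hN (block_subset_innerBlock (hA hxA))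

lemma visited_eq_card_of_mem_coversBy (hω : ω ∈ coversBy d N j A t) :
    visited d N j A t ω = A.card := by
  classical
  have hvisited : ∀ x ∈ A, entranceFrom {x} 0 ω ≤ departure d N j ⌊t⌋₊ ω := by
    intro x hx
    obtain ⟨n, hn, hnx⟩ := hω x hx
    exact (entranceFrom_le (by simp) hnx).trans hn
  rw [visited, Finset.sum_boole, Finset.filter_true_of_mem hvisited]

lemma visited_mem_Icc : visited d N j A t ω ∈ Set.Icc (0 : ℝ) A.card := by
  classical
  rw [visited, Finset.sum_boole]
  exact ⟨Nat.cast_nonneg _, Nat.cast_le.2 (Finset.card_filter_le _ _)⟩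

variable [NeZero N]

lemma measurable_departure (k : ℕ) : Measurable (departure d N j k) := by
  rw [funext (departure_eq_excursionEnd d N j k)]
  exact measurable_excursionEnd k

lemma measurable_visited : Measurable (visited d N j A t) := by
  classical
  refine Finset.measurable_sum _ fun x _ => Measurable.ite ?_ measurable_const measurable_const
  exact ((measurable_entranceFrom measurable_const).prodMk (measurable_departure _))
    (MeasurableSet.of_discrete (s := {p : ℕ∞ × ℕ∞ | p.1 ≤ p.2}))

lemma isProbabilityMeasure_cylLaw (hN : 3 ≤ N) : IsProbabilityMeasure (cylLaw d N) := by
  have := (isStepSet_steps d hN).isProbabilityMeasure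
  have : IsProbabilityMeasure (uniformOn (innerBlock d N 0)) := by
    rw [← coe_initialBlock]
    exact isProbabilityMeasure_uniformOn (Finset.finite_toSet _) initialBlock_nonempty
  rw [cylLaw]
  infer_instance

lemma integrable_exp_mul_visited (hN : 3 ≤ N) :
    Integrable (fun ω => Real.exp (lam * visited d N j A t ω)) (cylLaw d N) := by
  have := isProbabilityMeasure_cylLaw (d := d) hN
  exact integrable_exp_mul_of_mem_Icc measurable_visited.aemeasurable
    (ae_of_all _ fun _ => visited_mem_Icc)

lemma lintegral_exp_mul_visited_le (hN : 3 ≤ N) (hA : (A : Set (Cylinder d N)) ⊆ block d N j)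
    (ht : 0 < ⌊t⌋₊) (hlam : 0 ≤ lam) {C : ENNReal}
    (hC : ∀ n, ∫⁻ ω, visitWeight lam (A : Set (Cylinder d N)) n (departure d N j ⌊t⌋₊ ω) ω
      ∂cylLaw d N ≤ C) :
    ∫⁻ ω, ENNReal.ofReal (Real.exp (lam * visited d N j A t ω)) ∂cylLaw d N ≤ C := by
  calc ∫⁻ ω, ENNReal.ofReal (Real.exp (lam * visited d N j A t ω)) ∂cylLaw d N
      ≤ ∫⁻ ω, ⨆ n, visitWeight lam (A : Set (Cylinder d N)) n (departure d N j ⌊t⌋₊ ω) ω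
          ∂cylLaw d N := by
        refine lintegral_mono_ae ?_
        filter_upwards [ae_departure_lt_top hN j ⌊t⌋₊] with ω hω
        obtain ⟨τ, hτ⟩ := ENat.ne_top_iff_exists.1 hω.ne
        refine le_iSup_of_le τ ?_
        rw [visitWeight, ← hτ]
        gcongr
        exact visited_le_visitsBefore (by omega) hA ht hτ.symm
    _ = ⨆ n, ∫⁻ ω, visitWeight lam (A : Set (Cylinder d N)) n (departure d N j ⌊t⌋₊ ω) ω
          ∂cylLaw d N := by
        refine lintegral_iSup (fun n => measurable_visitWeight lam _ n (measurable_departure _))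
          fun n n' hnn' ω => ?_
        exact ENNReal.ofReal_le_ofReal (Real.exp_le_exp.2 (mul_le_mul_of_nonneg_left
          (Nat.cast_le.2 (visitsBefore_mono _ _ ω hnn')) hlam))
    _ ≤ C := iSup_le hC

end Visited

/-! ### The exponential moment and covering -/

section CylinderMoment

lemma outsideBound_succ_le_add {G ι : Type*} [AddCommGroup G] [Fintype ι] {E : ι → G}
    {A B D : Set G} {γ W : ℝ} {n k : ℕ} {z : G} (hW : 1 ≤ W) :
    outsideBound E A B D γ W n (k + 1) z ≤
      W ^ k * (W + γ * B.indicator (hitProb E D A n) z) := by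
  by_cases hz : z ∈ B
  · rw [outsideBound, if_pos hz, insideBound, Set.indicator_of_mem hz, mul_comm]
    gcongr
  · rw [outsideBound, if_neg hz, Set.indicator_of_notMem hz, mul_zero, add_zero, pow_succ]

lemma pow_mul_add_le_exp {a b : ℝ} (ha : 0 ≤ a) (hb : 0 ≤ b) (k : ℕ) :
    (1 + a) ^ k * (1 + a + b) ≤ Real.exp ((k + 1 : ℕ) * (a + b)) := by
  have hexp := Real.add_one_le_exp (a + b)
  rw [Real.exp_nat_mul, pow_succ]
  gcongr <;> linarith

/-- The constant of the exponential moment bound: `freqConst` enters once for the first entrance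
from a uniform starting point, and twice for the entrances from the boundary of `B_j`. -/
noncomputable def momentConst (d : ℕ) : ℝ := (d + 1) * (3 * freqConst d + 6)

lemma momentConst_pos (d : ℕ) : 0 < momentConst d := by
  have := freqConst_pos d
  unfold momentConst
  positivity

variable {d N m : ℕ} {j : ℤ} {A : Finset (Cylinder d N)} {lam : ℝ}

lemma abs_snd_sub_eq_of_notMem_innerBlock {z x : Cylinder d N} (hz : z ∉ innerBlock d N j)
    (hx : x ∈ innerBlock d N j) (hxz : |x.2 - z.2| ≤ 1) : |x.2 - j * N| = N := by
  obtain ⟨hx1, hx2⟩ := hx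
  have hz' : ¬((j - 1) * N ≤ z.2 ∧ z.2 ≤ (j + 1) * N) := hz
  rw [sub_mul, one_mul] at hx1 hz'
  rw [add_mul, one_mul] at hx2 hz'
  rw [abs_le] at hxz
  generalize j * (N : ℤ) = a at *
  rw [abs_eq (by omega)]
  omega

lemma lintegral_cylLaw_le [NeZero N] (hN : 3 ≤ N) {f : (ℕ → Cylinder d N) → ENNReal}
    (hf : Measurable f) {φ : Cylinder d N → ℝ} {b : ℝ} (hφ : 0 ≤ φ)
    (hle : ∀ z, ∫⁻ ω, f ω ∂walkLaw (Measure.dirac z) (steps d N) ≤ ENNReal.ofReal (φ z))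
    (hsum : ∑ z ∈ initialBlock d N, φ z ≤ (initialBlock d N).card * b) :
    ∫⁻ ω, f ω ∂cylLaw d N ≤ ENNReal.ofReal b := by
  have hcard : (0 : ℝ) < (initialBlock d N).card := Nat.cast_pos.2 initialBlock_nonempty.card_pos
  rw [lintegral_cylLaw hN hf]
  calc (∑ z ∈ initialBlock d N, ∫⁻ ω, f ω ∂walkLaw (Measure.dirac z) (steps d N)) /
        (initialBlock d N).card
      ≤ (∑ z ∈ initialBlock d N, ENNReal.ofReal (φ z)) / (initialBlock d N).card := by
        gcongr with z
        exact hle z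
    _ = ENNReal.ofReal ((∑ z ∈ initialBlock d N, φ z) / (initialBlock d N).card) := by
        rw [ENNReal.ofReal_div_of_pos hcard, ENNReal.ofReal_sum_of_nonneg fun z _ => hφ z,
          ENNReal.ofReal_natCast]
    _ ≤ ENNReal.ofReal b := by
        gcongr
        rwa [div_le_iff₀' hcard]

lemma hitProb_le_of_step_from_compl_innerBlock [NeZero N] (hd : 0 < d)
    (hA : (A : Set (Cylinder d N)) ⊆ block d N j) (n : ℕ) {z x : Cylinder d N}
    (hz : z ∉ innerBlock d N j) (hxz : |x.2 - z.2| ≤ 1) (hx : x ∈ innerBlock d N j) :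
    hitProb (cylVec d N) (outerBlock d N j) A n x ≤
      A.card * ((d + 1) * (2 * freqConst d + 3) * (N / (N : ℝ) ^ d)) :=
  hitProb_le_of_abs_snd_sub_eq hd hA n (abs_snd_sub_eq_of_notMem_innerBlock hz hx hxz)

lemma sum_mul_add_hitProb_le [NeZero N] (hd : 0 < d) (hA : (A : Set (Cylinder d N)) ⊆ block d N j)
    (n : ℕ) {a b c : ℝ} (ha : 0 ≤ a) (hc : 0 ≤ c) :
    ∑ z ∈ initialBlock d N, a * (b + c *
        (innerBlock d N j).indicator (hitProb (cylVec d N) (outerBlock d N j) A n) z) ≤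
      (initialBlock d N).card *
        (a * (b + c * (A.card * ((d + 1) * (freqConst d + 3) * (N / (N : ℝ) ^ d))))) := by
  rw [← Finset.mul_sum, Finset.sum_add_distrib, Finset.sum_const, nsmul_eq_mul, ← Finset.mul_sum]
  refine (mul_le_mul_of_nonneg_left (add_le_add_right
    (mul_le_mul_of_nonneg_left (sum_hitProb_le hd hA n) hc) _) ha).trans_eq ?_
  ring

lemma lintegral_visitWeight_cylLaw_le (hd : 0 < d) (hN : 3 ≤ N)
    (hA : (A : Set (Cylinder d N)) ⊆ block d N j) {γ ρ : ℝ} (hγ : 0 ≤ γ)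
    (hρ : Real.exp lam * (1 + γ * ρ) ≤ 1 + γ)
    (hret : ∀ z ∈ (A : Set (Cylinder d N)), ∀ n,
      stepAvg (cylVec d N) (hitProb (cylVec d N) (outerBlock d N j) A n) z ≤ ρ) (n k : ℕ) :
    ∫⁻ ω, visitWeight lam (A : Set (Cylinder d N)) n (departure d N j (k + 1) ω) ω ∂cylLaw d N ≤
      ENNReal.ofReal (Real.exp
        ((k + 1 : ℕ) * (γ * (A.card * (momentConst d * (N / (N : ℝ) ^ d)))))) := by
  have : NeZero N := ⟨by omega⟩
  have := freqConst_pos d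
  set η : ℝ := A.card * ((d + 1) * (2 * freqConst d + 3) * (N / (N : ℝ) ^ d)) with hη
  set H : ℝ := A.card * ((d + 1) * (freqConst d + 3) * (N / (N : ℝ) ^ d)) with hH
  have hη0 : 0 ≤ η := by positivity
  have hγη : 0 ≤ γ * η := mul_nonneg hγ hη0
  have hγH : 0 ≤ γ * H := by positivity
  have hwalk := (lintegral_visitWeight_le (isStepSet_steps d hN)
    (hA.trans block_subset_innerBlock) (innerBlock_subset_outerBlock (by omega)) hγ hη0 hρ hret
    (fun z hz i n =>
      ⟨hitProb_le_of_step_from_compl_innerBlock hd hA n hz (abs_snd_add_cylVec_le z i).1,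
        hitProb_le_of_step_from_compl_innerBlock hd hA n hz (abs_snd_add_cylVec_le z i).2⟩)
    n).2 (k + 1)
  have hsplit : γ * (A.card * (momentConst d * (N / (N : ℝ) ^ d))) = γ * η + γ * H := by
    rw [hη, hH, momentConst]
    ring
  simp only [departure_eq_excursionEnd]
  refine (lintegral_cylLaw_le hN measurable_visitWeight_excursionEnd (fun z => ?_) (fun z =>
    (hwalk z).trans (ENNReal.ofReal_le_ofReal (outsideBound_succ_le_add (by linarith))))
    (sum_mul_add_hitProb_le hd hA n (pow_nonneg (by linarith) k) hγ)).trans ?_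
  · have : 0 ≤ (innerBlock d N j).indicator (hitProb (cylVec d N) (outerBlock d N j) A n) z :=
      Set.indicator_nonneg (fun x _ => hitProb_nonneg n x) z
    simp only [Pi.zero_apply]
    positivity
  · rw [hsplit]
    exact ENNReal.ofReal_le_ofReal (pow_mul_add_le_exp hγη hγH k)

lemma exp_mul_one_add_eq {r : ℝ} (hr : Real.exp lam * r < 1) :
    Real.exp lam * (1 + 2 * ((Real.exp lam - 1) / (1 - Real.exp lam * r)) *
      (r + (1 - Real.exp lam * r) / (2 * Real.exp lam))) =
      1 + 2 * ((Real.exp lam - 1) / (1 - Real.exp lam * r)) := by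
  have := Real.exp_pos lam
  have : 1 - Real.exp lam * r ≠ 0 := by linarith
  field

lemma moment_rate_pos (hlam : 0 < lam) (hchi : chi d m lam < 1) :
    0 < (Real.exp lam - 1) / (1 - chi d m lam) :=
  div_pos (sub_pos.2 (Real.one_lt_exp_iff.2 hlam)) (sub_pos.2 hchi)

lemma eventually_floor_mul_pow_pos {u : ℝ} (hu : 0 < u) {p : ℕ} (hp : p ≠ 0) :
    ∀ᶠ N : ℕ in atTop, 0 < ⌊u * (N : ℝ) ^ p⌋₊ := by
  have htendsto : Tendsto (fun N : ℕ => u * (N : ℝ) ^ p) atTop atTop :=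
    ((tendsto_pow_atTop hp).comp tendsto_natCast_atTop_atTop).const_mul_atTop hu
  filter_upwards [htendsto.eventually_ge_atTop 1] with N hN
  exact Nat.floor_pos.2 hN

lemma floor_mul_div_pow_le {u : ℝ} (hu : 0 ≤ u) (hd : 0 < d) (hN : 0 < N) :
    ⌊u * (N : ℝ) ^ (d - 1)⌋₊ * (N / (N : ℝ) ^ d) ≤ u := by
  calc ⌊u * (N : ℝ) ^ (d - 1)⌋₊ * (N / (N : ℝ) ^ d)
      ≤ u * (N : ℝ) ^ (d - 1) * (N / (N : ℝ) ^ d) := by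
        gcongr
        exact Nat.floor_le (by positivity)
    _ = u := by
        rw [← pow_sub_one_mul hd.ne']
        field

/-- The factor `2` leaves room for replacing the return probability `r` to a full lattice section by
`r + ε` with `χ + e^λ ε = (1 + χ) / 2`. -/
lemma eventually_lintegral_exp_mul_visited_le (hd : 3 ≤ d) (hm : m ≤ d - 2) (hlam : 0 < lam)
    (hchi : chi d m lam < 1) {u : ℝ} (hu : 0 < u) :
    ∀ᶠ N : ℕ in atTop, ∀ j, ∀ A ∈ admissible d N m j,
      ∫⁻ ω, ENNReal.ofReal (Real.exp (lam * visited d N j A (u * (N : ℝ) ^ (d - 1)) ω))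
          ∂cylLaw d N ≤
        ENNReal.ofReal (Real.exp
          (2 * momentConst d * u * ((Real.exp lam - 1) / (1 - chi d m lam)) * A.card)) := by
  set g := (Real.exp lam - 1) / (1 - chi d m lam) with hg
  have hg0 : 0 < g := moment_rate_pos hlam hchi
  have := momentConst_pos d
  have hε : 0 < (1 - chi d m lam) / (2 * Real.exp lam) := div_pos (sub_pos.2 hchi) (by positivity)
  filter_upwards [eventually_stepAvg_hitProb_le hd hm hε, eventually_ge_atTop 3,
    eventually_floor_mul_pow_pos hu (p := d - 1) (by omega)] with N hret hN hfloor j A hA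
  obtain ⟨-, hAblock, F, hF, hAF⟩ := hA
  have : NeZero N := ⟨by omega⟩
  refine lintegral_exp_mul_visited_le hN hAblock hfloor hlam.le fun n => ?_
  obtain ⟨k, hk⟩ := Nat.exists_eq_add_one.2 hfloor
  rw [hk]
  refine (lintegral_visitWeight_cylLaw_le (γ := 2 * g) (by omega) hN hAblock (by positivity)
    (exp_mul_one_add_eq hchi).le (fun z hz n => (stepAvg_mono (hitProb_mono_set hAF n) z).trans
      (hret j F hF z (hAF hz) n)) n k).trans (ENNReal.ofReal_le_ofReal (Real.exp_le_exp.2 ?_))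
  calc ((k + 1 : ℕ) : ℝ) * (2 * g * (A.card * (momentConst d * (N / (N : ℝ) ^ d))))
      = 2 * momentConst d * (((k + 1 : ℕ) : ℝ) * (N / (N : ℝ) ^ d)) * g * A.card := by ring
    _ ≤ 2 * momentConst d * u * g * A.card := by
        rw [← hk]
        gcongr
        exact floor_mul_div_pow_le hu.le (by omega) (by omega)

lemma eventually_mgf_visited_le (hd : 3 ≤ d) (hm : m ≤ d - 2) (hlam : 0 < lam)
    (hchi : chi d m lam < 1) {u : ℝ} (hu : 0 < u) :
    ∀ᶠ N : ℕ in atTop, ∀ j, ∀ A ∈ admissible d N m j,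
      mgf (visited d N j A (u * (N : ℝ) ^ (d - 1))) (cylLaw d N) lam ≤
        Real.exp (2 * momentConst d * u * ((Real.exp lam - 1) / (1 - chi d m lam)) * A.card) := by
  filter_upwards [eventually_lintegral_exp_mul_visited_le hd hm hlam hchi hu,
    eventually_ge_atTop 3] with N hle hN j A hA
  have : NeZero N := ⟨by omega⟩
  rw [mgf, integral_eq_lintegral_of_nonneg_ae (ae_of_all _ fun ω => (Real.exp_pos _).le)
    (integrable_exp_mul_visited hN).aestronglyMeasurable]
  exact ENNReal.toReal_le_of_le_ofReal (Real.exp_pos _).le (hle j A hA)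

lemma eventually_log_mgf_visited_le (hd : 3 ≤ d) (hm : m ≤ d - 2) (hlam : 0 < lam)
    (hchi : chi d m lam < 1) {u : ℝ} (hu : 0 < u) :
    ∀ᶠ N : ℕ in atTop, ∀ j, ∀ A ∈ admissible d N m j,
      (A.card : ℝ)⁻¹ * Real.log (mgf (visited d N j A (u * (N : ℝ) ^ (d - 1))) (cylLaw d N) lam) ≤
        2 * momentConst d * u * ((Real.exp lam - 1) / (1 - chi d m lam)) := by
  filter_upwards [eventually_mgf_visited_le hd hm hlam hchi hu, eventually_ge_atTop 3]
    with N hle hN j A hA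
  have : NeZero N := ⟨by omega⟩
  have := isProbabilityMeasure_cylLaw (d := d) hN
  rw [inv_mul_le_iff₀ (Nat.cast_pos.2 hA.1.card_pos), mul_comm (A.card : ℝ),
    Real.log_le_iff_le_exp (mgf_pos (integrable_exp_mul_visited hN))]
  exact hle j A hA

lemma coversBy_real_le_exp_mul_mgf (hN : 3 ≤ N) (hlam : 0 ≤ lam) (t : ℝ) :
    (cylLaw d N).real (coversBy d N j A t) ≤
      Real.exp (-lam * A.card) * mgf (visited d N j A t) (cylLaw d N) lam := by
  have : NeZero N := ⟨by omega⟩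
  have := isProbabilityMeasure_cylLaw (d := d) hN
  refine (measure_ge_le_exp_mul_mgf _ hlam (integrable_exp_mul_visited hN)).trans'
    (measureReal_mono fun ω hω => ?_)
  exact (visited_eq_card_of_mem_coversBy hω).ge

lemma exists_gt_chi_lt_one (hchi : chi d m lam < 1) : ∃ lam' > lam, chi d m lam' < 1 := by
  have hcont : Continuous (chi d m) := by
    unfold chi
    fun_prop
  have hnear : ∀ᶠ l in nhdsWithin lam (Set.Ioi lam), chi d m l < 1 :=
    ((hcont.tendsto lam).eventually_lt_const hchi).filter_mono nhdsWithin_le_nhds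
  exact ((eventually_mem_nhdsWithin (s := Set.Ioi lam)).and hnear).exists

lemma exists_eventually_coversBy_le (hd : 3 ≤ d) (hm : m ≤ d - 2) (hlam : 0 < lam)
    (hchi : chi d m lam < 1) :
    ∃ u > 0, ∀ᶠ N : ℕ in atTop, ∀ j, ∀ A ∈ admissible d N m j,
      (cylLaw d N).real (coversBy d N j A (u * (N : ℝ) ^ (d - 1))) ≤
        Real.exp (-(lam * A.card)) := by
  obtain ⟨lam', hlt, hchi'⟩ := exists_gt_chi_lt_one hchi
  have hlam' : 0 < lam' := hlam.trans hlt
  set g := (Real.exp lam' - 1) / (1 - chi d m lam') with hg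
  have hg0 : 0 < g := moment_rate_pos hlam' hchi'
  have hc := momentConst_pos d
  have hu : 0 < (lam' - lam) / (2 * momentConst d * g) := div_pos (sub_pos.2 hlt) (by positivity)
  refine ⟨_, hu, ?_⟩
  filter_upwards [eventually_mgf_visited_le hd hm hlam' hchi' hu, eventually_ge_atTop 3]
    with N hle hN j A hA
  refine (coversBy_real_le_exp_mul_mgf hN hlam'.le _).trans ?_
  calc Real.exp (-lam' * A.card) *
        mgf (visited d N j A ((lam' - lam) / (2 * momentConst d * g) * (N : ℝ) ^ (d - 1)))
          (cylLaw d N) lam'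
      ≤ Real.exp (-lam' * A.card) * Real.exp (2 * momentConst d *
          ((lam' - lam) / (2 * momentConst d * g)) * g * A.card) := by
        gcongr
        exact hle j A hA
    _ = Real.exp (-(lam * A.card)) := by
        rw [← Real.exp_add]
        congr 1
        field_simp
        ring

end CylinderMoment

end CylinderWalk

open CylinderWalk in
theorem theorem1p2 (d : ℕ) (hd : 3 ≤ d) :
    ∃ c : ℝ, 0 < c ∧
      ∀ m : ℕ, 1 ≤ m → m ≤ d - 2 →
      ∀ lam : ℝ, 0 < lam → CylinderWalk.chi d m lam < 1 →
        (∀ u : ℝ, 0 < u →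
          limsup (fun N : ℕ => ⨆ (j : ℤ), ⨆ A ∈ CylinderWalk.admissible d N m j,
              ((((A.card : ℝ)⁻¹ * Real.log (∫ ω,
                Real.exp (lam * CylinderWalk.visited d N j A (u * (N : ℝ) ^ (d - 1)) ω)
                  ∂(CylinderWalk.cylLaw d N))) : ℝ) : EReal)) atTop
            ≤ ((c * u * ((Real.exp lam - 1) / (1 - CylinderWalk.chi d m lam)) : ℝ) : EReal)) ∧
        ∃ N₁ : ℕ, 0 < N₁ ∧ ∃ u₁ : ℝ, 0 < u₁ ∧
          ∀ N : ℕ, N₁ ≤ N → ∀ j : ℤ, ∀ A ∈ CylinderWalk.admissible d N m j,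
            (CylinderWalk.cylLaw d N).real
                (CylinderWalk.coversBy d N j A (u₁ * (N : ℝ) ^ (d - 1)))
              ≤ Real.exp (-(lam * A.card)) := by
  have hc := momentConst_pos d
  refine ⟨2 * momentConst d, by positivity, fun m _ hm lam hlam hchi => ⟨fun u hu => ?_, ?_⟩⟩
  · refine limsup_le_of_le (by isBoundedDefault) ?_
    filter_upwards [eventually_log_mgf_visited_le hd hm hlam hchi hu] with N hle
    exact iSup_le fun j => iSup₂_le fun A hA => EReal.coe_le_coe_iff.2 (hle j A hA)
  · obtain ⟨u₁, hu₁, hcover⟩ := exists_eventually_coversBy_le hd hm hlam hchi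
    obtain ⟨N₁, hN₁⟩ := eventually_atTop.1 hcover
    exact ⟨N₁ + 1, N₁.succ_pos, u₁, hu₁, fun N hN => hN₁ N (Nat.le_of_succ_le hN)⟩
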